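/- **Setting.** Let $d\ge 0$ be an integer, $\sigma>0$, and let $k$ be the squared exponential kernel $k(x,x')=\exp(-\|x-x'\|^2/(2l^2))$, $l>0$, or the Matérn kernel $k(x,x')=\frac{2^{1-\nu}}{\Gamma(\nu)}\bigl(\frac{\sqrt{2\nu}\|x-x'\|}{l}\bigr)^{\nu}K_\nu\bigl(\frac{\sqrt{2\nu}\|x-x'\|}{l}\bigr)$, $k(x,x)=1$, with $\nu,l>0$ and $K_\nu$ the modified Bessel function of the second kind. Let $\mathcal X\subset[0,1]^d$ be finite and non-empty, $D:\mathcal X\times\mathcal X\to\mathbb R$ and $\xi\in\mathbb R$ such that $\Delta_\xi(x)=\{x'-x: x'\in\mathcal X,\ D(x,x')\le\xi\}$ is non-empty for every $x\in\mathcal X$, and let $f:\mathcal X\to\mathbb R$ lie in the reproducing kernel Hilbert space of $k$ on $\mathcal X$ with norm at most $\Psi$, $\Psi>0$. Let $x^*$ maximize $\min_{\delta'\in\Delta_\xi(x)}f(x+\delta')$ over $x\in\mathcal X$, and define the $\xi$-regret $r_\xi(x)=\min_{\delta'\in\Delta_\xi(x^*)}f(x^*+\delta')-\min_{\delta'\in\Delta_\xi(x)}f(x+\delta')$.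 At each time $t=1,\dots,T$ an algorithm chooses $x_t\in\mathcal X$ and $\delta_t\in\Delta_\xi(x_t)$, and the query is answered by $y_t=f(x_t+\delta_t)+z_t$ with $z_1,\dots,z_T$ independent $N(0,\sigma^2)$; answers are revealed only at the end of a batch. Let $R_{\xi,T}=\sum_{t=1}^T r_\xi(x_t)$. Let $\gamma_t$ be the maximum, over sequences $A$ of $t$ points of $\mathcal X$ (repetitions allowed), of the mutual information $I(f_A;f_A+z_A)$, where $f_A$ is the vector of values at $A$ of a centred Gaussian process with covariance $k$ and $z_A\sim N(0,\sigma^2 I)$ is independent of $f_A$. For $\delta\in(0,1)$ put $\Lambda=\Psi+\sqrt{\log(|\mathcal X|/\delta)}$. **Algorithm (Robust-BPE).** For $a\in(0,1)$ the batch sizes are $N_i=\min\{\lceil T^{1-a^i}\rceil,\ T-\sum_{j<i}N_j\}$, $i=1,\dots,B$, where $B$ is the least number of batches with $\sum_{i\le B}N_i=T$. Put $\mathcal X_1=\mathcal X$ and $\sqrt\beta=\Psi+\sqrt{2\log(|\mathcal X|B/\delta)}$. In batch $i$, at each time $t$ of the batch, the algorithm chooses, with an arbitrary deterministic tie-breaking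 rule (a function of $i$, $\mathcal X_i$ and the points queried so far in the batch), a pair $x_t\in\mathcal X_i$, $\delta_t\in\Delta_\xi(x_t)$ for which $x_t+\delta_t$ has the largest posterior variance among all points $x+\delta'$ with $x\in\mathcal X_i$, $\delta'\in\Delta_\xi(x)$, given the points already queried in batch $i$. Let $\mu^i$ and $(\sigma^i)^2$ be the posterior mean and variance given all the data of batch $i$ (zero-mean Gaussian process prior with covariance $k$, regularization $\sigma^2$), and $\mathrm{UCB}_i=\mu^i+\sqrt\beta\,\sigma^i$, $\mathrm{LCB}_i=\mu^i-\sqrt\beta\,\sigma^i$. After the batch, $\mathcal X_{i+1}$ is the set of all $x\in\mathcal X_i$ with $\min_{\delta'\in\Delta_\xi(x)}\mathrm{UCB}_i(x+\delta')\ge\max_{x'\in\mathcal X_i}\min_{\delta'\in\Delta_\xi(x')}\mathrm{LCB}_i(x'+\delta')$. **Theorem.** (1) For either kernel and $a\in(\frac12,1)$ there are constants $C,T_0$ that depend only on $d,\sigma,k,a$ such that for all $T\ge T_0$, all $\mathcal X,D,\xi,f,\Psi$ as above and all $\delta\in(0,1)$, with probability at least $1-\delta$, Robust-BPE satisfies both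 $$R_{\xi,T}\le C\bigl(\Lambda+\sqrt{\log\log\log T}\bigr)\sqrt{T\gamma_T}\quad\text{and}\quad r_\xi(x_T)\le C\bigl(\Lambda+\sqrt{\log\log\log T}\bigr)\sqrt{\gamma_T/T}.$$ (2) For the Matérn kernel and $a\in(\frac{\nu}{2\nu+d},\frac12]$, let $\overline\gamma_t=c'\,t^{d/(2\nu+d)}\alpha_t$ with $c'>0$ and a real sequence $\alpha$ for which there are $K,T_1$ such that $\alpha_{N_i}\le K\alpha_T$ for all $T\ge T_1$ and all $1\le i<B$, where $N_i,B$ are those of horizon $T$ (any $\alpha$ that is non-decreasing on $t\ge1$ qualifies), and let $t_0\in\mathbb N$. Then there are constants $C,T_0$ that depend only on $d,\sigma,\nu,l,a,c',\alpha,t_0$ such that for all $T\ge T_0$, all $\mathcal X,D,\xi,f,\Psi$ as above for which $\gamma_t\le\overline\gamma_t$ for every $t\ge t_0$, and all $\delta\in(0,1)$, with probability at least $1-\delta$, Robust-BPE satisfies $$R_{\xi,T}\le C\bigl(\Lambda+\sqrt{\log\log\log T}\bigr)\sqrt{T\overline\gamma_T},\qquad r_\xi(x_T)\le C\bigl(\Lambda+\sqrt{\log\log\log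 T}\bigr)\sqrt{\overline\gamma_T/T},$$ and $r_\xi(x_T)\le C\bigl(\Lambda+\sqrt{\log\log\log T}\bigr)(\log T)\sqrt{\gamma_T/T}$. In particular, up to $\Lambda$ and dimension-independent logarithmic factors, the point $x_T$ has simple $\xi$-regret $O^*(\sqrt{\gamma_T/T})$ in both cases. -/

import Mathlib

open MeasureTheory ProbabilityTheory

noncomputable section

namespace RobustBPE

/-! ### Kernels -/

/-- The squared exponential kernel with length-scale `l`. -/
def seKernel {d : ℕ} (l : ℝ) (x y : EuclideanSpace ℝ (Fin d)) : ℝ :=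
  Real.exp (-(dist x y) ^ 2 / (2 * l ^ 2))

/-- The modified Bessel function of the second kind `K_ν(z)`, for `z > 0`. -/
def besselK (ν z : ℝ) : ℝ :=
  ∫ t in Set.Ioi (0 : ℝ), Real.exp (-z * Real.cosh t) * Real.cosh (ν * t)

/-- The Matérn kernel with smoothness `ν` and length-scale `l`. On the diagonal, where the formula
reads `0 * ∞`, it takes its limit value `1`. -/
def maternKernel {d : ℕ} (ν l : ℝ) (x y : EuclideanSpace ℝ (Fin d)) : ℝ :=
  if x = y then 1
  else 2 ^ (1 - ν) / Real.Gamma ν * (Real.sqrt (2 * ν) * dist x y / l) ^ ν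
    * besselK ν (Real.sqrt (2 * ν) * dist x y / l)

/-- `f` lies in the reproducing kernel Hilbert space on `ι` with kernel `κ`, and its norm there is
at most `Ψ`. -/
def RKHSNormLE {ι : Type} (κ : ι → ι → ℝ) (f : ι → ℝ) (Ψ : ℝ) : Prop :=
  ∃ (H : Type) (_ : NormedAddCommGroup H) (_ : InnerProductSpace ℝ H) (_ : CompleteSpace H)
    (_ : RKHS ℝ H ι ℝ), (∀ x y, RKHS.kernel H x y 1 = κ x y) ∧
      ∃ g : H, (∀ x, g x = f x) ∧ ‖g‖ ≤ Ψ

/-! ### Maximum information gain -/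

/-- The mutual information of two random variables: the Kullback-Leibler divergence of their joint
law from the product of their laws. -/
def mutualInfo {Ω α β : Type*} [MeasurableSpace Ω] [MeasurableSpace α] [MeasurableSpace β]
    (U : Ω → α) (V : Ω → β) (μ : Measure Ω) : ENNReal :=
  InformationTheory.klDiv (μ.map fun ω => (U ω, V ω)) ((μ.map U).prod (μ.map V))

/-- The kernel matrix of a finite sequence of points. -/
def kernelMatrix {ι : Type} (κ : ι → ι → ℝ) {n : ℕ} (p : Fin n → ι) :
    Matrix (Fin n) (Fin n) ℝ :=
  Matrix.of fun i j => κ (p i) (p j)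

/-- The information gain `I(f_A; y_A)` of a sequence of points `p`: here `f_A` is the vector of
values at `p` of a centred Gaussian process with covariance `κ`, and `y_A = f_A + z` with
`z ∼ N(0, σ² I)` independent of `f_A`. -/
def infoGain {ι : Type} (κ : ι → ι → ℝ) (σ : ℝ) {n : ℕ} (p : Fin n → ι) : ℝ :=
  (mutualInfo Prod.fst (fun v => v.1 + v.2)
    ((multivariateGaussian 0 (kernelMatrix κ p)).prod
      (multivariateGaussian 0 (σ ^ 2 • (1 : Matrix (Fin n) (Fin n) ℝ))))).toReal

/-- The maximum information gain `γ_t`, over all choices of `t` points (repetitions allowed). -/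
def maxInfoGain {ι : Type} (κ : ι → ι → ℝ) (σ : ℝ) (t : ℕ) : ℝ :=
  ⨆ p : Fin t → ι, infoGain κ σ p

/-! ### Gaussian process posterior -/

/-- The posterior mean at `x` after the observations `y` at the points `p` (regularization
parameter `σ²`). -/
def postMean {ι : Type} (κ : ι → ι → ℝ) (σ : ℝ) {n : ℕ} (p : Fin n → ι) (y : Fin n → ℝ)
    (x : ι) : ℝ :=
  (fun i => κ (p i) x) ⬝ᵥ
    (Matrix.mulVec (kernelMatrix κ p + σ ^ 2 • (1 : Matrix (Fin n) (Fin n) ℝ))⁻¹ y)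

/-- The posterior variance at `x` after sampling the points `p`. -/
def postVar {ι : Type} (κ : ι → ι → ℝ) (σ : ℝ) {n : ℕ} (p : Fin n → ι) (x : ι) : ℝ :=
  κ x x - (fun i => κ (p i) x) ⬝ᵥ
    (Matrix.mulVec (kernelMatrix κ p + σ ^ 2 • (1 : Matrix (Fin n) (Fin n) ℝ))⁻¹
      (fun i => κ (p i) x))

/-- The posterior standard deviation at `x` after sampling the points of the list `L`. -/
def postStd {ι : Type} (κ : ι → ι → ℝ) (σ : ℝ) (L : List ι) (x : ι) : ℝ :=
  Real.sqrt (postVar κ σ L.get x)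

/-! ### Batch sizes -/

/-- The last time `t_i = N_1 + ⋯ + N_i` of the `i`-th batch, where
`N_i = min {⌈T^(1-a^i)⌉, T - t_{i-1}}`. -/
def batchEnd (a : ℝ) (T : ℕ) : ℕ → ℕ
  | 0 => 0
  | i + 1 => batchEnd a T i + min ⌈(T : ℝ) ^ (1 - a ^ (i + 1))⌉₊ (T - batchEnd a T i)

/-- The size `N_i` of the `i`-th batch, `i ≥ 1`. -/
def batchSize (a : ℝ) (T i : ℕ) : ℕ :=
  min ⌈(T : ℝ) ^ (1 - a ^ i)⌉₊ (T - batchEnd a T (i - 1))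

/-- The number of batches `B`: the least number of batches that exhaust the horizon `T`. -/
def numBatches (a : ℝ) (T : ℕ) : ℕ := sInf {B | batchEnd a T B = T}

/-- The batch that contains the time `t`, for `1 ≤ t ≤ T`: the least `i` with `t ≤ t_i`. -/
def batchIndex (a : ℝ) (T t : ℕ) : ℕ := sInf {i | t ≤ batchEnd a T i}

/-! ### The robust optimization problem -/

/-- A robust problem: a finite non-empty domain `X` in the unit cube, a function `D` and a level `ξ`
that determine the perturbations (each point has at least one), and a function `f` of norm at
most `Ψ` in the reproducing kernel Hilbert space of the kernel `k` on `X`. -/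
structure RobustInstance (d : ℕ)
    (k : EuclideanSpace ℝ (Fin d) → EuclideanSpace ℝ (Fin d) → ℝ) where
  X : Finset (EuclideanSpace ℝ (Fin d))
  nonempty : X.Nonempty
  mem_cube : ∀ x ∈ X, ∀ j, x j ∈ Set.Icc (0 : ℝ) 1
  D : X → X → ℝ
  ξ : ℝ
  exists_perturbation : ∀ x : X, ∃ x' : X, D x x' ≤ ξ
  f : X → ℝ
  Ψ : ℝ
  Ψ_pos : 0 < Ψ
  norm_le : RKHSNormLE (fun x y : X => k x y) f Ψ

namespace RobustInstance

variable {d : ℕ} {k : EuclideanSpace ℝ (Fin d) → EuclideanSpace ℝ (Fin d) → ℝ}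

/-- The kernel on the domain. -/
def κ (I : RobustInstance d k) (x y : I.X) : ℝ := k x y

/-- `min_{δ ∈ Δ_ξ(x)} g(x + δ)`; the points `x + δ` with `δ ∈ Δ_ξ(x)` are the points `x'` of the
domain with `D x x' ≤ ξ`. -/
def worst (I : RobustInstance d k) (g : I.X → ℝ) (x : I.X) : ℝ :=
  ⨅ x' : {x' : I.X // I.D x x' ≤ I.ξ}, g x'

/-- `x` is a `ξ`-robust optimal point. -/
def IsRobustOptimal (I : RobustInstance d k) (x : I.X) : Prop :=
  ∀ x', I.worst I.f x' ≤ I.worst I.f x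

/-- The `ξ`-regret of `x`, relative to the `ξ`-robust optimal point `xs`. -/
def regret (I : RobustInstance d k) (xs x : I.X) : ℝ := I.worst I.f xs - I.worst I.f x

/-- `Λ = Ψ + √(log (|X| / δ))`. -/
def Lam (I : RobustInstance d k) (δ : ℝ) : ℝ := I.Ψ + Real.sqrt (Real.log (I.X.card / δ))

/-- `√β = Ψ + √(2 log (|X| B / δ))`. -/
def sqrtBeta (I : RobustInstance d k) (δ : ℝ) (B : ℕ) : ℝ :=
  I.Ψ + Real.sqrt (2 * Real.log (I.X.card * B / δ))

/-- The maximum information gain `γ_t` on the domain, for noise variance `σ²`. -/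
def gam (I : RobustInstance d k) (σ : ℝ) (t : ℕ) : ℝ := maxInfoGain I.κ σ t

/-! ### The algorithm Robust-BPE -/

/-- `sel` is a rule for the maximum variance step, with an arbitrary tie-breaking: in batch `i`, with
the non-empty set `A` of remaining candidates, after the queries `L` of this batch, it picks a
candidate `x ∈ A` and a perturbed point `x' = x + δ`, `δ ∈ Δ_ξ(x)`, that has the largest posterior
standard deviation among all perturbed points of all candidates. -/
def IsMaxVarianceRule (I : RobustInstance d k) (σ : ℝ)
    (sel : ℕ → Finset I.X → List I.X → I.X × I.X) : Prop :=
  ∀ (i : ℕ) (A : Finset I.X) (L : List I.X), A.Nonempty →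
    (sel i A L).1 ∈ A ∧ I.D (sel i A L).1 (sel i A L).2 ≤ I.ξ ∧
      ∀ x ∈ A, ∀ x', I.D x x' ≤ I.ξ →
        postStd I.κ σ L x' ≤ postStd I.κ σ L (sel i A L).2

/-- The first `n` queried points `x_t + δ_t` of batch `i`, when the set of candidates is `A`. -/
def queries (I : RobustInstance d k) (sel : ℕ → Finset I.X → List I.X → I.X × I.X)
    (i : ℕ) (A : Finset I.X) : ℕ → List I.X
  | 0 => []
  | n + 1 => I.queries sel i A n ++ [(sel i A (I.queries sel i A n)).2]

/-- The posterior mean from the queries `L` of a batch that starts after time `s`, where the query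
at time `t` is answered by the value of `f` plus the noise `w t`. -/
def batchMean (I : RobustInstance d k) (σ : ℝ) (L : List I.X) (s : ℕ) (w : ℕ → ℝ) (x : I.X) : ℝ :=
  postMean I.κ σ L.get (fun j => I.f (L.get j) + w (s + j + 1)) x

/-- The upper confidence bound of a batch; `b` stands for `√β`. -/
def ucb (I : RobustInstance d k) (σ b : ℝ) (L : List I.X) (s : ℕ) (w : ℕ → ℝ) (x : I.X) : ℝ :=
  I.batchMean σ L s w x + b * postStd I.κ σ L x

/-- The lower confidence bound of a batch; `b` stands for `√β`. -/
def lcb (I : RobustInstance d k) (σ b : ℝ) (L : List I.X) (s : ℕ) (w : ℕ → ℝ) (x : I.X) : ℝ :=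
  I.batchMean σ L s w x - b * postStd I.κ σ L x

open Classical in
/-- The candidates that survive: those whose worst-case upper confidence bound is at least the
worst-case lower confidence bound of every candidate. -/
def eliminate (I : RobustInstance d k) (σ b : ℝ) (A : Finset I.X) (L : List I.X) (s : ℕ)
    (w : ℕ → ℝ) : Finset I.X :=
  A.filter fun x => ∀ x' ∈ A, I.worst (I.lcb σ b L s w) x' ≤ I.worst (I.ucb σ b L s w) x

/-- The candidates that remain after the first `i` batches of Robust-BPE with horizon `T` and
confidence parameter `δ`, on the noise path `w`; so `active … (i - 1)` is the set of candidates
used in batch `i`. -/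
def active (I : RobustInstance d k) (σ a : ℝ) (T : ℕ) (δ : ℝ)
    (sel : ℕ → Finset I.X → List I.X → I.X × I.X) (w : ℕ → ℝ) : ℕ → Finset I.X
  | 0 => Finset.univ
  | i + 1 =>
    I.eliminate σ (I.sqrtBeta δ (numBatches a T)) (I.active σ a T δ sel w i)
      (I.queries sel (i + 1) (I.active σ a T δ sel w i) (batchSize a T (i + 1)))
      (batchEnd a T i) w

/-- The point `x_t` and the queried point `x_t + δ_t` that Robust-BPE chooses at time `t`,
`1 ≤ t ≤ T`, on the noise path `w`. -/
def chosen (I : RobustInstance d k) (σ a : ℝ) (T : ℕ) (δ : ℝ)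
    (sel : ℕ → Finset I.X → List I.X → I.X × I.X) (w : ℕ → ℝ) (t : ℕ) : I.X × I.X :=
  sel (batchIndex a T t) (I.active σ a T δ sel w (batchIndex a T t - 1))
    (I.queries sel (batchIndex a T t) (I.active σ a T δ sel w (batchIndex a T t - 1))
      (t - batchEnd a T (batchIndex a T t - 1) - 1))

/-- The `ξ`-regret of the point `x_t`. -/
def regretAt (I : RobustInstance d k) (σ a : ℝ) (T : ℕ) (δ : ℝ)
    (sel : ℕ → Finset I.X → List I.X → I.X × I.X) (xs : I.X) (w : ℕ → ℝ) (t : ℕ) : ℝ :=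
  I.regret xs (I.chosen σ a T δ sel w t).1

/-- The cumulative `ξ`-regret `R_{ξ,T}`. -/
def cumRegret (I : RobustInstance d k) (σ a : ℝ) (T : ℕ) (δ : ℝ)
    (sel : ℕ → Finset I.X → List I.X → I.X × I.X) (xs : I.X) (w : ℕ → ℝ) : ℝ :=
  ∑ t ∈ Finset.Icc 1 T, I.regretAt σ a T δ sel xs w t

end RobustInstance

/-! ### Noise, and well-behaved bounds -/

/-- `z_1, …, z_T` are independent `N(0, σ²)` random variables. -/
def IsGaussianNoise {Ω : Type*} [MeasurableSpace Ω] (σ : ℝ) (T : ℕ) (μ : Measure Ω)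
    (z : ℕ → Ω → ℝ) : Prop :=
  (∀ t ∈ Finset.Icc 1 T, Measurable (z t)) ∧
  (∀ t ∈ Finset.Icc 1 T, HasLaw (z t) (gaussianReal 0 (σ ^ 2).toNNReal) μ) ∧
  iIndepFun (fun t : Finset.Icc 1 T => z t) μ

/-- `√(log log log T)`. -/
def sqrtLogLogLog (T : ℕ) : ℝ := Real.sqrt (Real.log (Real.log (Real.log T)))

/-- The sequence `γ̄_t = c t^{d/(2ν+d)} α_t`. -/
def gammaBar (d : ℕ) (ν c : ℝ) (α : ℕ → ℝ) (t : ℕ) : ℝ :=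
  c * (t : ℝ) ^ ((d : ℝ) / (2 * ν + d)) * α t

/-- `α_{N_i} = O(α_T)` as `T → ∞`, uniformly over the batches `1 ≤ i < B` of horizon `T`. Every `α`
that is non-decreasing on `t ≥ 1` has this property. -/
def WellBehaved (a : ℝ) (α : ℕ → ℝ) : Prop :=
  ∃ (K : ℝ) (T₁ : ℕ), ∀ T ≥ T₁, ∀ i, 1 ≤ i → i < numBatches a T →
    α (batchSize a T i) ≤ K * α T

end RobustBPE

end

/-!
The regret analysis of batched elimination, for an arbitrary kernel with `k x x = 1`; the squared
exponential and the Matérn formula enter only through that identity. Positive semidefiniteness is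
supplied by the reproducing kernel Hilbert space that contains `f`, which provides a feature map
`κ x y = ⟪φ x, φ y⟫`.

*Information gain.* With `M = K + σ² I`, the joint law of `f_A` and `f_A + z` has a density with
respect to the product of its marginals even if `K` is singular, namely the quotient of the
densities of `N(0, σ² I)` at `y - f` and of `N(0, M)` at `y`. Both quadratic forms have the same
expectation, so the information gain is `½ log det (σ⁻² M)` (`infoGain_eq`). The Schur complement
turns one more observation into the summand `½ log (1 + σ⁻² s)`, `s` being the posterior variance
of the new point (`infoGain_snoc`). The posterior variance is the minimum of a regularized
least-squares functional (`postVar_eq_ridge`), hence decreases with more data; since each query has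
the largest variance, `N` queries push all variances below `2 γ_N / (N log (1 + σ⁻²))`
(`mul_postVar_queries_le`).

*Confidence.* The error of the posterior mean is a bias of size at most `Ψ h` plus a Gaussian of
standard deviation `τ`, where `h² + τ²` is the posterior variance (`abs_sub_postMean_le`). The tail
bound `P(|N(0,1)| > u) ≤ exp (-u²/2)` has no factor `2`, which is exactly what the union bound over
`|X|` points and `B` batches with the given `β` needs. The queries of a batch depend only on
earlier noise, so conditioning on the candidate set reduces to fixed queries
(`measure_batch_fails_le`, `le_measure_confidenceHolds`).

*Regret.* While the confidence intervals hold, the optimal point is never eliminated, and the points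
that survive batch `i` have regret at most `4 √β` times the largest posterior deviation of that
batch (`regret_le_of_mem_active_succ`). If `γ_N ≤ G N^η` on the batch sizes, batch `i + 1`
contributes `√G T^((1+η)/2) T^(-s a^i)` up to constants, with `s = a - (1-η)/2 > 0`. These factors
grow doubly exponentially in `i` while `T^(a^B)` is bounded above and `T^(a^(B-2)) ≥ 2`, so their
sum is bounded (`sum_batchSize_mul_le`), and `B = O(log log T)` gives the triple logarithm.
The first batch costs `2 Ψ N_1`; this is dominated because `γ_T` is bounded below by a constant and,
for `a ≤ 1/2`, because the growth condition on `α` bounds `α` below by every negative power of `T`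
(`WellBehaved.exists_rpow_le`).
-/

noncomputable section

namespace RobustBPE

/-! ### Gaussian densities and the divergence of a noisy observation -/

lemma withDensity_comp_map {α β : Type*} [MeasurableSpace α] [MeasurableSpace β] {μ : Measure α}
    {g : α → β} (hg : Measurable g) {h : β → ENNReal} (hh : Measurable h) :
    (μ.withDensity (h ∘ g)).map g = (μ.map g).withDensity h := by
  ext s hs
  rw [Measure.map_apply hg hs, withDensity_apply _ (hg hs), withDensity_apply _ hs,
    setLIntegral_map hs hh hg]
  rfl

open scoped RealInnerProductSpace in
/-- The standard Gaussian measure has the expected density. Its normalizing constant `c` cancels in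
all divergences below and is left unspecified. -/
lemma stdGaussian_eq_withDensity (ι : Type*) [Fintype ι] :
    ∃ c : ℝ, 0 < c ∧ stdGaussian (EuclideanSpace ℝ ι) =
      volume.withDensity (fun x => ENNReal.ofReal (c * Real.exp (-‖x‖ ^ 2 / 2))) := by
  have key : ∀ t : EuclideanSpace ℝ ι,
      ∫ x : EuclideanSpace ℝ ι, Complex.exp (⟪x, t⟫ * Complex.I) * (Real.exp (-‖x‖ ^ 2 / 2) : ℝ) =
      ((2 * Real.pi) ^ (Fintype.card ι / 2 : ℝ) : ℝ) * Complex.exp (-‖t‖ ^ 2 / 2) := by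
    intro t
    have h := GaussianFourier.integral_cexp_neg_mul_sq_norm_add_of_euclideanSpace (b := 1 / 2)
      (by norm_num) Complex.I t
    have h2 : ((Real.pi / (1 / 2 : ℂ)) ^ (Fintype.card ι / 2 : ℂ)) =
        ((2 * Real.pi) ^ (Fintype.card ι / 2 : ℝ) : ℝ) := by
      rw [Complex.ofReal_cpow (by positivity)]
      push_cast
      congr 1
      ring
    rw [h2] at h
    convert h using 2
    · ext x
      push_cast
      rw [← Complex.exp_add]
      congr 1
      rw [real_inner_comm]
      ring
    · congr 1
      rw [Complex.I_sq]
      ring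
  have hpos : 0 < (2 * Real.pi) ^ (Fintype.card ι / 2 : ℝ) := by positivity
  set C := (2 * Real.pi) ^ (Fintype.card ι / 2 : ℝ) with hC
  have hint0 : ∫ x : EuclideanSpace ℝ ι, Real.exp (-‖x‖ ^ 2 / 2) = C := by
    have := key 0
    simp only [inner_zero_right, Complex.ofReal_zero, zero_mul, Complex.exp_zero, one_mul,
      norm_zero] at this
    rw [integral_complex_ofReal] at this
    have := Complex.ofReal_injective (this.trans (b := _) (c := (C : ℂ)) (by simp))
    exact this
  have hint : Integrable (fun x : EuclideanSpace ℝ ι => C⁻¹ * Real.exp (-‖x‖ ^ 2 / 2)) := by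
    refine Integrable.const_mul ?_ _
    by_contra h
    rw [integral_undef h] at hint0
    exact hpos.ne hint0
  refine ⟨C⁻¹, by positivity, ?_⟩
  have hfin : IsFiniteMeasure (volume.withDensity
      (fun x : EuclideanSpace ℝ ι => ENNReal.ofReal (C⁻¹ * Real.exp (-‖x‖ ^ 2 / 2)))) :=
    isFiniteMeasure_withDensity_ofReal hint.2
  refine Measure.ext_of_charFun ?_
  ext t
  rw [charFun_stdGaussian, charFun_apply, integral_withDensity_eq_integral_toReal_smul
    (by fun_prop) (by simp)]
  have : ∀ x : EuclideanSpace ℝ ι, (ENNReal.ofReal (C⁻¹ * Real.exp (-‖x‖ ^ 2 / 2))).toReal •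
      Complex.exp (⟪x, t⟫ * Complex.I) =
      (C⁻¹ : ℂ) * (Complex.exp (⟪x, t⟫ * Complex.I) * (Real.exp (-‖x‖ ^ 2 / 2) : ℝ)) := by
    intro x
    rw [ENNReal.toReal_ofReal (by positivity), Complex.real_smul]
    push_cast
    ring
  simp_rw [this]
  rw [integral_const_mul, key t, ← mul_assoc, inv_mul_cancel₀ (by exact_mod_cast hpos.ne'), one_mul]

/-- The density of the centred Gaussian measure with covariance `L Lᵀ`, `L` invertible. -/
lemma map_stdGaussian_eq_withDensity {ι : Type*} [Fintype ι] {c : ℝ}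
    (hstd : stdGaussian (EuclideanSpace ℝ ι) =
      volume.withDensity (fun x => ENNReal.ofReal (c * Real.exp (-‖x‖ ^ 2 / 2))))
    (L : EuclideanSpace ℝ ι ≃L[ℝ] EuclideanSpace ℝ ι) :
    (stdGaussian (EuclideanSpace ℝ ι)).map L =
      volume.withDensity (fun y => ENNReal.ofReal
        (|LinearMap.det (L : EuclideanSpace ℝ ι →ₗ[ℝ] EuclideanSpace ℝ ι)|⁻¹ *
          (c * Real.exp (-‖L.symm y‖ ^ 2 / 2)))) := by
  have hdet : LinearMap.det (L : EuclideanSpace ℝ ι →ₗ[ℝ] EuclideanSpace ℝ ι) ≠ 0 :=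
    (LinearEquiv.isUnit_det' L.toLinearEquiv).ne_zero
  have h1 : (fun x : EuclideanSpace ℝ ι => ENNReal.ofReal (c * Real.exp (-‖x‖ ^ 2 / 2))) =
      (fun y => ENNReal.ofReal (c * Real.exp (-‖L.symm y‖ ^ 2 / 2))) ∘ L := by
    ext x; simp
  rw [hstd, h1, withDensity_comp_map (by fun_prop) (by fun_prop)]
  have h2 := Measure.map_linearMap_addHaar_eq_smul_addHaar
    (volume : Measure (EuclideanSpace ℝ ι)) hdet
  have h3 : Measure.map (⇑L) (volume : Measure (EuclideanSpace ℝ ι)) = ENNReal.ofReal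
    |(LinearMap.det (L : EuclideanSpace ℝ ι →ₗ[ℝ] EuclideanSpace ℝ ι))⁻¹| • volume := h2
  rw [h3, withDensity_smul_measure, ← withDensity_smul _ (by fun_prop)]
  congr 1
  ext y
  rw [Pi.smul_apply, smul_eq_mul, ← ENNReal.ofReal_mul (abs_nonneg _), abs_inv]

/-- The divergence of the law of `(f, f + z)`, with `f ∼ F` and `z ∼ Z` independent, from `F × Y`,
where `Z` and `Y` have densities `φ` and `ψ` with respect to a translation invariant measure. The
shear `(f, z) ↦ (f, f + z)` preserves `F × V`, so no density of `F` is needed. -/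
lemma toReal_klDiv_shear {E : Type*} [NormedAddCommGroup E] [InnerProductSpace ℝ E]
    [FiniteDimensional ℝ E] [MeasurableSpace E] [BorelSpace E]
    (V : Measure E) [V.IsAddLeftInvariant] [SFinite V]
    (F Z Y : Measure E) [IsProbabilityMeasure F] [IsProbabilityMeasure Z] [IsProbabilityMeasure Y]
    {φ ψ : E → ℝ} (hφ : Measurable φ) (hψ : Measurable ψ) (hφ0 : ∀ x, 0 < φ x)
    (hψ0 : ∀ x, 0 < ψ x) (hZ : Z = V.withDensity fun x => ENNReal.ofReal (φ x))
    (hY : Y = V.withDensity fun x => ENNReal.ofReal (ψ x)) :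
    (InformationTheory.klDiv ((F.prod Z).map fun v => (v.1, v.1 + v.2)) (F.prod Y)).toReal =
      ∫ v, (Real.log (φ v.2) - Real.log (ψ (v.1 + v.2))) ∂(F.prod Z) := by
  have hsh : Measurable fun v : E × E => (v.1, v.1 + v.2) := by fun_prop
  set r : E × E → ENNReal := fun v => ENNReal.ofReal (φ (v.2 - v.1) / ψ v.2) with hr
  have hrm : Measurable r := by fun_prop
  have hJ : (F.prod Z).map (fun v => (v.1, v.1 + v.2)) =
      (F.prod V).withDensity fun v => ENNReal.ofReal (φ (v.2 - v.1)) := by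
    rw [hZ, prod_withDensity_right (by fun_prop)]
    have h1 : (fun a : E × E => ENNReal.ofReal (φ a.2)) =
        (fun v => ENNReal.ofReal (φ (v.2 - v.1))) ∘ (fun v : E × E => (v.1, v.1 + v.2)) := by
      ext v; simp
    rw [h1, withDensity_comp_map hsh (by fun_prop), (measurePreserving_prod_add F V).map_eq]
  have hQ : F.prod Y = (F.prod V).withDensity fun v => ENNReal.ofReal (ψ v.2) := by
    rw [hY, prod_withDensity_right (by fun_prop)]
  have hJQ : (F.prod Z).map (fun v => (v.1, v.1 + v.2)) = (F.prod Y).withDensity r := by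
    rw [hJ, hQ, ← withDensity_mul _ (by fun_prop) hrm]
    congr 1
    ext v
    rw [Pi.mul_apply, hr, ← ENNReal.ofReal_mul (hψ0 _).le, mul_div_cancel₀ _ (hψ0 _).ne']
  have hac : (F.prod Z).map (fun v => (v.1, v.1 + v.2)) ≪ F.prod Y := by
    rw [hJQ]; exact withDensity_absolutelyContinuous _ _
  have hPJ : IsProbabilityMeasure ((F.prod Z).map (fun v => (v.1, v.1 + v.2))) :=
    Measure.isProbabilityMeasure_map hsh.aemeasurable
  rw [InformationTheory.toReal_klDiv_of_measure_eq hac (by simp)]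
  have hllr : llr ((F.prod Z).map fun v => (v.1, v.1 + v.2)) (F.prod Y)
      =ᵐ[(F.prod Z).map fun v => (v.1, v.1 + v.2)]
      fun v => Real.log (φ (v.2 - v.1)) - Real.log (ψ v.2) := by
    refine hac.ae_le ?_
    have := Measure.rnDeriv_withDensity (F.prod Y) hrm
    rw [← hJQ] at this
    filter_upwards [this] with v hv
    rw [llr, hv, hr, ENNReal.toReal_ofReal (div_nonneg (hφ0 _).le (hψ0 _).le),
      Real.log_div (hφ0 _).ne' (hψ0 _).ne']
  rw [integral_congr_ae hllr, integral_map hsh.aemeasurable]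
  · simp
  · exact Measurable.aestronglyMeasurable (by fun_prop)

/-! ### The information gain as a log-determinant -/

open scoped MatrixOrder in
/-- A nondegenerate centred Gaussian measure is the image of the standard one under an invertible
map, the square root of the covariance matrix. -/
lemma exists_multivariateGaussian_eq_map {ι : Type*} [Fintype ι] [DecidableEq ι]
    {M : Matrix ι ι ℝ} (hM : M.PosDef) :
    ∃ L : EuclideanSpace ℝ ι ≃L[ℝ] EuclideanSpace ℝ ι,
      multivariateGaussian 0 M = (stdGaussian (EuclideanSpace ℝ ι)).map L ∧
      |LinearMap.det (L : EuclideanSpace ℝ ι →ₗ[ℝ] EuclideanSpace ℝ ι)| = √M.det := by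
  have hsq : CFC.sqrt M * CFC.sqrt M = M := CFC.sqrt_mul_sqrt_self _ hM.posSemidef.nonneg
  have hdet : (CFC.sqrt M).det * (CFC.sqrt M).det = M.det := by rw [← Matrix.det_mul, hsq]
  have hu : IsUnit (CFC.sqrt M) := by
    rw [Matrix.isUnit_iff_isUnit_det, isUnit_iff_ne_zero]
    intro h
    rw [h, zero_mul] at hdet
    exact hM.det_pos.ne hdet
  have hu' := hu.map (Matrix.toEuclideanCLM (n := ι) (𝕜 := ℝ))
  refine ⟨ContinuousLinearEquiv.ofUnit hu'.unit, ?_, ?_⟩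
  · rw [multivariateGaussian]
    congr 1
    ext x i
    simp [ContinuousLinearEquiv.ofUnit]
  · have h1 : ((ContinuousLinearEquiv.ofUnit hu'.unit : EuclideanSpace ℝ ι ≃L[ℝ] _) :
        EuclideanSpace ℝ ι →ₗ[ℝ] EuclideanSpace ℝ ι) = Matrix.toEuclideanLin (CFC.sqrt M) := by
      ext x i
      simp [ContinuousLinearEquiv.ofUnit]
    have h2 : LinearMap.det (Matrix.toEuclideanLin (CFC.sqrt M)) = (CFC.sqrt M).det := by
      rw [Matrix.toEuclideanLin_eq_toLin_orthonormal, LinearMap.det_toLin]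
    rw [h1, h2, ← hdet, Real.sqrt_mul_self_eq_abs]

/-- The information gain is `½ log det (I + σ⁻² K)`; the kernel matrix `K` may be singular. -/
lemma infoGain_eq {ι : Type} (κ : ι → ι → ℝ) {σ : ℝ} (hσ : 0 < σ) {n : ℕ} (p : Fin n → ι)
    (hK : (kernelMatrix κ p).PosSemidef) :
    infoGain κ σ p = 1 / 2 * (Real.log (kernelMatrix κ p +
      σ ^ 2 • (1 : Matrix (Fin n) (Fin n) ℝ)).det - n * Real.log (σ ^ 2)) := by
  set K := kernelMatrix κ p
  set S : Matrix (Fin n) (Fin n) ℝ := σ ^ 2 • 1 with hS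
  have hSpd : S.PosDef := Matrix.PosDef.one.smul (by positivity)
  have hMpd : (K + S).PosDef := Matrix.PosDef.posSemidef_add hK hSpd
  have hSdet : S.det = (σ ^ 2) ^ n := by simp [hS]
  obtain ⟨c, hc, hstd⟩ := stdGaussian_eq_withDensity (Fin n)
  obtain ⟨Ls, hLs, hLsd⟩ := exists_multivariateGaussian_eq_map hSpd
  obtain ⟨Lm, hLm, hLmd⟩ := exists_multivariateGaussian_eq_map hMpd
  have hsum : ((multivariateGaussian 0 K).prod (multivariateGaussian 0 S)).map
      (fun v => v.1 + v.2) = multivariateGaussian 0 (K + S) := by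
    refine Measure.ext_of_charFun ?_
    ext t
    have := charFun_conv (μ := multivariateGaussian 0 K) (ν := multivariateGaussian 0 S) t
    rw [Measure.conv] at this
    rw [this, charFun_multivariateGaussian hK, charFun_multivariateGaussian hSpd.posSemidef,
      charFun_multivariateGaussian hMpd.posSemidef, ← Complex.exp_add, Matrix.add_mulVec,
      dotProduct_add]
    congr 1
    simp only [inner_zero_right, Complex.ofReal_zero]
    push_cast
    ring
  have hds : 0 < √S.det := Real.sqrt_pos.2 hSpd.det_pos
  have hdm : 0 < √(K + S).det := Real.sqrt_pos.2 hMpd.det_pos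
  have hZ := hLs.trans (map_stdGaussian_eq_withDensity hstd Ls)
  have hY := hLm.trans (map_stdGaussian_eq_withDensity hstd Lm)
  rw [hLsd] at hZ
  rw [hLmd] at hY
  have hsqint : Integrable (fun x : EuclideanSpace ℝ (Fin n) => ‖x‖ ^ 2) (stdGaussian _) :=
    (IsGaussian.memLp_two_id (μ := stdGaussian (EuclideanSpace ℝ (Fin n)))).integrable_norm_pow
      (by norm_num)
  have hlog : ∀ (b : ℝ), 0 < b → ∀ (y : EuclideanSpace ℝ (Fin n)),
      Real.log (b⁻¹ * (c * Real.exp (-‖y‖ ^ 2 / 2))) =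
        Real.log c - Real.log b - ‖y‖ ^ 2 / 2 := by
    intro b hb y
    rw [Real.log_mul (by positivity) (by positivity), Real.log_mul (by positivity) (by positivity),
      Real.log_exp, Real.log_inv]
    ring
  have hadd : Measurable fun v : EuclideanSpace ℝ (Fin n) × EuclideanSpace ℝ (Fin n) =>
    v.1 + v.2 := by fun_prop
  -- both log-densities are, in law, a constant minus half the squared norm of a standard Gaussian
  have hgen : ∀ (b : ℝ), 0 < b →
      Integrable (fun x : EuclideanSpace ℝ (Fin n) => Real.log c - Real.log b - ‖x‖ ^ 2 / 2)
        (stdGaussian _) ∧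
      ∫ x, (Real.log c - Real.log b - ‖x‖ ^ 2 / 2) ∂(stdGaussian (EuclideanSpace ℝ (Fin n))) =
        Real.log c - Real.log b - (∫ x, ‖x‖ ^ 2 / 2 ∂(stdGaussian (EuclideanSpace ℝ (Fin n)))) := by
    intro b _
    refine ⟨(integrable_const _).sub (hsqint.div_const 2), ?_⟩
    rw [integral_sub (integrable_const _) (hsqint.div_const 2)]
    simp
  have h1m : MeasurePreserving (fun v : EuclideanSpace ℝ (Fin n) × EuclideanSpace ℝ (Fin n) =>
      Ls.symm v.2) ((multivariateGaussian 0 K).prod (multivariateGaussian 0 S)) (stdGaussian _) := by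
    refine MeasurePreserving.comp (g := Ls.symm) ⟨by fun_prop, ?_⟩ measurePreserving_snd
    rw [hLs, Measure.map_map (by fun_prop) (by fun_prop)]
    simp
  have h2m : MeasurePreserving (fun v : EuclideanSpace ℝ (Fin n) × EuclideanSpace ℝ (Fin n) =>
      Lm.symm (v.1 + v.2)) ((multivariateGaussian 0 K).prod (multivariateGaussian 0 S))
      (stdGaussian _) := by
    refine MeasurePreserving.comp (g := Lm.symm) (μb := multivariateGaussian 0 (K + S))
      ⟨by fun_prop, ?_⟩ ⟨hadd, hsum⟩
    rw [hLm, Measure.map_map (by fun_prop) (by fun_prop)]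
    simp
  have hfst : ((multivariateGaussian 0 K).prod (multivariateGaussian 0 S)).map Prod.fst =
      multivariateGaussian 0 K := measurePreserving_fst.map_eq
  rw [infoGain, mutualInfo, hfst, hsum, toReal_klDiv_shear volume _ _ _ (by fun_prop) (by fun_prop)
    (fun x => by positivity) (fun x => by positivity) hZ hY]
  simp_rw [hlog _ hds, hlog _ hdm]
  have i1 := h1m.integrable_comp_of_integrable (hgen _ hds).1
  have i2 := h2m.integrable_comp_of_integrable (hgen _ hdm).1
  have j1 := integral_map (μ := (multivariateGaussian 0 K).prod (multivariateGaussian 0 S))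
    h1m.measurable.aemeasurable (f := fun x => Real.log c - Real.log √S.det - ‖x‖ ^ 2 / 2)
    (by rw [h1m.map_eq]; exact (hgen _ hds).1.aestronglyMeasurable)
  have j2 := integral_map (μ := (multivariateGaussian 0 K).prod (multivariateGaussian 0 S))
    h2m.measurable.aemeasurable (f := fun x => Real.log c - Real.log √(K + S).det - ‖x‖ ^ 2 / 2)
    (by rw [h2m.map_eq]; exact (hgen _ hdm).1.aestronglyMeasurable)
  rw [h1m.map_eq, (hgen _ hds).2] at j1
  rw [h2m.map_eq, (hgen _ hdm).2] at j2
  refine (integral_sub i1 i2).trans ?_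
  simp only [Function.comp_apply]
  rw [← j1, ← j2, Real.log_sqrt hSpd.det_pos.le, Real.log_sqrt hMpd.det_pos.le,
    hSdet, Real.log_pow]
  ring

/-! ### Posterior variance as a regularized least-squares minimum -/

section Posterior

variable {ι : Type} {H : Type} [NormedAddCommGroup H] [InnerProductSpace ℝ H]

/-- `φ` is a feature map of the kernel `κ`. -/
def IsFeatureMap (κ : ι → ι → ℝ) (φ : ι → H) : Prop :=
  ∀ x y, κ x y = inner ℝ (φ x) (φ y)

/-- The regularized kernel matrix `K + σ² I`. -/
def regMatrix (κ : ι → ι → ℝ) (σ : ℝ) {n : ℕ} (p : Fin n → ι) : Matrix (Fin n) (Fin n) ℝ :=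
  kernelMatrix κ p + σ ^ 2 • (1 : Matrix (Fin n) (Fin n) ℝ)

/-- The weights `(K + σ² I)⁻¹ k(x)` of the observations in the posterior mean at `x`. -/
def postWeights (κ : ι → ι → ℝ) (σ : ℝ) {n : ℕ} (p : Fin n → ι) (x : ι) : Fin n → ℝ :=
  (regMatrix κ σ p)⁻¹.mulVec fun i => κ (p i) x

/-- The regularized least-squares functional `‖φ(x) - ∑ w_i φ(p_i)‖² + σ² |w|²`. The posterior
variance at `x` is its minimum over the weights `w`. -/
def ridge (φ : ι → H) (σ : ℝ) {n : ℕ} (p : Fin n → ι) (x : ι) (w : Fin n → ℝ) : ℝ :=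
  ‖φ x - ∑ i, w i • φ (p i)‖ ^ 2 + σ ^ 2 * ∑ i, w i ^ 2

variable {κ : ι → ι → ℝ} {φ : ι → H} {σ : ℝ} {n : ℕ}

lemma kernelMatrix_posSemidef (hφ : IsFeatureMap κ φ) (p : Fin n → ι) :
    (kernelMatrix κ p).PosSemidef := by
  have : kernelMatrix κ p = Matrix.gram ℝ fun i => φ (p i) := by
    ext i j
    simp [kernelMatrix, Matrix.gram, hφ (p i) (p j)]
  rw [this]
  exact Matrix.posSemidef_gram _ _

lemma regMatrix_posDef (hφ : IsFeatureMap κ φ) (hσ : 0 < σ) (p : Fin n → ι) :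
    (regMatrix κ σ p).PosDef :=
  Matrix.PosDef.posSemidef_add (kernelMatrix_posSemidef hφ p)
    (Matrix.PosDef.one.smul (by positivity))

lemma ridge_eq (hφ : IsFeatureMap κ φ) (p : Fin n → ι) (x : ι) (w : Fin n → ℝ) :
    ridge φ σ p x w = κ x x - 2 * ((fun i => κ (p i) x) ⬝ᵥ w) +
      w ⬝ᵥ (regMatrix κ σ p).mulVec w := by
  have h1 : inner ℝ (φ x) (∑ i, w i • φ (p i)) = (fun i => κ (p i) x) ⬝ᵥ w := by
    simp [inner_sum, inner_smul_right, dotProduct, hφ _ _, real_inner_comm, mul_comm]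
  have h2 : inner ℝ (∑ i, w i • φ (p i)) (∑ i, w i • φ (p i)) =
      w ⬝ᵥ (kernelMatrix κ p).mulVec w := by
    simp only [sum_inner, inner_sum, inner_smul_right, inner_smul_left, dotProduct, Matrix.mulVec,
      kernelMatrix, Matrix.of_apply, hφ _ _, Finset.mul_sum, conj_trivial]
    exact Finset.sum_congr rfl fun i _ => Finset.sum_congr rfl fun j _ => by
      rw [real_inner_comm]; ring
  rw [ridge, norm_sub_sq_real, ← real_inner_self_eq_norm_sq, ← real_inner_self_eq_norm_sq, h1, h2,
    regMatrix, Matrix.add_mulVec, dotProduct_add, ← hφ x x, Matrix.smul_mulVec, Matrix.one_mulVec,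
    dotProduct_smul, smul_eq_mul]
  simp only [dotProduct, sq]
  ring

lemma regMatrix_mulVec_postWeights (hφ : IsFeatureMap κ φ) (hσ : 0 < σ) (p : Fin n → ι) (x : ι) :
    (regMatrix κ σ p).mulVec (postWeights κ σ p x) = fun i => κ (p i) x := by
  have := (regMatrix_posDef hφ hσ p).isUnit
  rw [Matrix.isUnit_iff_isUnit_det] at this
  rw [postWeights, Matrix.mulVec_mulVec, Matrix.mul_nonsing_inv _ this, Matrix.one_mulVec]

lemma regMatrix_bilin_comm (hφ : IsFeatureMap κ φ) (hσ : 0 < σ) (p : Fin n → ι)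
    (v w : Fin n → ℝ) :
    v ⬝ᵥ (regMatrix κ σ p).mulVec w = (regMatrix κ σ p).mulVec v ⬝ᵥ w := by
  have h := (regMatrix_posDef hφ hσ p).isHermitian
  rw [Matrix.IsHermitian, Matrix.conjTranspose_eq_transpose_of_trivial] at h
  rw [Matrix.dotProduct_mulVec, ← Matrix.mulVec_transpose, h]

lemma postVar_eq (p : Fin n → ι) (x : ι) :
    postVar κ σ p x = κ x x - (fun i => κ (p i) x) ⬝ᵥ postWeights κ σ p x := rfl

/-- Completing the square in `ridge`. -/
lemma ridge_eq_postVar_add (hφ : IsFeatureMap κ φ) (hσ : 0 < σ) (p : Fin n → ι) (x : ι)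
    (w : Fin n → ℝ) :
    ridge φ σ p x w = postVar κ σ p x +
      (w - postWeights κ σ p x) ⬝ᵥ (regMatrix κ σ p).mulVec (w - postWeights κ σ p x) := by
  have h := regMatrix_mulVec_postWeights hφ hσ p x
  rw [ridge_eq hφ, postVar_eq, Matrix.mulVec_sub, h, sub_dotProduct, dotProduct_sub, dotProduct_sub,
    regMatrix_bilin_comm hφ hσ p (postWeights κ σ p x) w, h, dotProduct_comm w fun i => κ (p i) x,
    dotProduct_comm (postWeights κ σ p x)]
  ring

lemma postVar_le_ridge (hφ : IsFeatureMap κ φ) (hσ : 0 < σ) (p : Fin n → ι) (x : ι)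
    (w : Fin n → ℝ) : postVar κ σ p x ≤ ridge φ σ p x w := by
  rw [ridge_eq_postVar_add hφ hσ]
  have := (regMatrix_posDef hφ hσ p).posSemidef.dotProduct_mulVec_nonneg
    (w - postWeights κ σ p x)
  simpa using this

lemma postVar_eq_ridge (hφ : IsFeatureMap κ φ) (hσ : 0 < σ) (p : Fin n → ι) (x : ι) :
    postVar κ σ p x = ridge φ σ p x (postWeights κ σ p x) := by
  simp [ridge_eq_postVar_add hφ hσ]

lemma postVar_nonneg (hφ : IsFeatureMap κ φ) (hσ : 0 < σ) (p : Fin n → ι) (x : ι) :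
    0 ≤ postVar κ σ p x := by
  rw [postVar_eq_ridge hφ hσ, ridge]
  positivity

lemma postVar_le_diag (hφ : IsFeatureMap κ φ) (hσ : 0 < σ) (p : Fin n → ι) (x : ι) :
    postVar κ σ p x ≤ κ x x := by
  refine (postVar_le_ridge hφ hσ p x 0).trans ?_
  simp [ridge, hφ x x]

/-- More data do not increase the posterior variance: the new observation may get weight `0`. -/
lemma postVar_snoc_le (hφ : IsFeatureMap κ φ) (hσ : 0 < σ) (p : Fin n → ι) (y x : ι) :
    postVar κ σ (Fin.snoc p y : Fin (n + 1) → ι) x ≤ postVar κ σ p x := by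
  rw [postVar_eq_ridge hφ hσ p]
  refine (postVar_le_ridge hφ hσ _ x (Fin.snoc (postWeights κ σ p x) 0)).trans_eq ?_
  simp [ridge, Fin.sum_univ_castSucc]

/-- The posterior variance plus `σ²` is the Schur complement of one more observation. -/
lemma det_regMatrix_snoc (hφ : IsFeatureMap κ φ) (hσ : 0 < σ) (p : Fin n → ι) (y : ι) :
    (regMatrix κ σ (Fin.snoc p y : Fin (n + 1) → ι)).det =
      (regMatrix κ σ p).det * (σ ^ 2 + postVar κ σ p y) := by
  have hu := (regMatrix_posDef hφ hσ p).isUnit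
  let _ := hu.invertible
  have hblock : (regMatrix κ σ (Fin.snoc p y : Fin (n + 1) → ι)).submatrix finSumFinEquiv
      finSumFinEquiv = Matrix.fromBlocks (regMatrix κ σ p)
        (Matrix.of fun i _ => κ (p i) y) (Matrix.of fun (_ : Fin 1) j => κ (p j) y)
        (Matrix.of fun _ _ => κ y y + σ ^ 2) := by
    have hl : ∀ i : Fin n, (Fin.castAdd 1 i : Fin (n + 1)) = i.castSucc := fun _ => rfl
    have hr : ∀ j : Fin 1, (Fin.natAdd n j : Fin (n + 1)) = Fin.last n := by
      intro j; ext; simp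
    ext (i | i) (j | j)
    · simp [regMatrix, kernelMatrix, hl, Matrix.one_apply]
    · simp [regMatrix, kernelMatrix, hl, hr, (Fin.castSucc_lt_last _).ne]
    · simp [regMatrix, kernelMatrix, hl, hr, (Fin.castSucc_lt_last _).ne',
        hφ _ _, real_inner_comm]
    · simp [regMatrix, kernelMatrix, hr]
  rw [← Matrix.det_submatrix_equiv_self finSumFinEquiv, hblock, Matrix.det_fromBlocks₁₁]
  congr 1
  rw [Matrix.det_unique, postVar_eq, postWeights]
  simp only [Matrix.sub_apply, Matrix.of_apply, Matrix.mul_assoc, Matrix.invOf_eq_nonsing_inv]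
  have : ((Matrix.of fun (_ : Fin 1) j => κ (p j) y) * ((regMatrix κ σ p)⁻¹ *
      (Matrix.of fun i (_ : Fin 1) => κ (p i) y))) default default =
      (fun i => κ (p i) y) ⬝ᵥ (regMatrix κ σ p)⁻¹.mulVec fun i => κ (p i) y := by
    simp [Matrix.mul_apply, dotProduct, Matrix.mulVec]
  rw [this]
  ring

/-- One more observation adds `½ log (1 + σ⁻² s)` to the information gain, where `s` is the
posterior variance at the new point. -/
lemma infoGain_snoc (hφ : IsFeatureMap κ φ) (hσ : 0 < σ) (p : Fin n → ι) (y : ι) :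
    infoGain κ σ (Fin.snoc p y : Fin (n + 1) → ι) =
      infoGain κ σ p + 1 / 2 * Real.log (1 + postVar κ σ p y / σ ^ 2) := by
  have h1 := infoGain_eq κ hσ p (kernelMatrix_posSemidef hφ p)
  have h2 := infoGain_eq κ hσ (Fin.snoc p y : Fin (n + 1) → ι) (kernelMatrix_posSemidef hφ _)
  have h3 := det_regMatrix_snoc hφ hσ p y
  have hv := postVar_nonneg hφ hσ p y
  have hd := (regMatrix_posDef hφ hσ p).det_pos
  rw [regMatrix, regMatrix] at h3
  rw [regMatrix] at hd
  have h4 : 1 + postVar κ σ p y / σ ^ 2 = (σ ^ 2 + postVar κ σ p y) / σ ^ 2 := by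
    field_simp
  rw [h1, h2, h3, Real.log_mul hd.ne' (by positivity), h4, Real.log_div (by positivity)
    (by positivity)]
  push_cast
  ring

/-- The deviation of the posterior mean from a function of the reproducing kernel Hilbert space
splits into a bias term and a noise term, whose squared sizes add up to the posterior variance. -/
lemma abs_sub_postMean_le (hφ : IsFeatureMap κ φ) (hσ : 0 < σ) {f : ι → ℝ} {g : H}
    (hf : ∀ x, f x = inner ℝ g (φ x)) (p : Fin n → ι) (e : Fin n → ℝ) (x : ι) :
    |f x - postMean κ σ p (fun i => f (p i) + e i) x| ≤
      ‖g‖ * ‖φ x - ∑ i, postWeights κ σ p x i • φ (p i)‖ +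
        |∑ i, postWeights κ σ p x i * e i| := by
  set w := postWeights κ σ p x
  have hmean : postMean κ σ p (fun i => f (p i) + e i) x = w ⬝ᵥ fun i => f (p i) + e i := by
    have hh := ((regMatrix_posDef hφ hσ p).inv).isHermitian
    rw [Matrix.IsHermitian, Matrix.conjTranspose_eq_transpose_of_trivial] at hh
    rw [postMean, Matrix.dotProduct_mulVec, ← Matrix.mulVec_transpose]
    change (Matrix.mulVec (regMatrix κ σ p)⁻¹.transpose _) ⬝ᵥ _ = _
    rw [hh]
    rfl
  have hsplit : f x - postMean κ σ p (fun i => f (p i) + e i) x =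
      inner ℝ g (φ x - ∑ i, w i • φ (p i)) - ∑ i, w i * e i := by
    rw [hmean, inner_sub_right, inner_sum]
    simp only [inner_smul_right, ← hf, dotProduct, mul_add, Finset.sum_add_distrib]
    ring
  rw [hsplit]
  exact (abs_sub _ _).trans (add_le_add (abs_real_inner_le_norm _ _) le_rfl)

end Posterior

/-! ### Posterior variances and the maximum information gain -/

section Lists

variable {ι : Type} {H : Type} [NormedAddCommGroup H] [InnerProductSpace ℝ H]
  {κ : ι → ι → ℝ} {φ : ι → H} {σ : ℝ}

lemma get_append_singleton (L : List ι) (y : ι) (i : Fin (L ++ [y]).length) :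
    (L ++ [y]).get i =
      (Fin.snoc L.get y : Fin (L.length + 1) → ι) (Fin.cast (by simp) i) := by
  rcases i with ⟨i, hi⟩
  have hi' : i < L.length + 1 := by simpa using hi
  by_cases h : i < L.length
  · simp [Fin.snoc, h, List.getElem_append_left]
  · have : i = L.length := by omega
    subst this
    simp [Fin.snoc]

lemma postVar_congr {m n : ℕ} (h : m = n) {p : Fin m → ι} {q : Fin n → ι}
    (hpq : ∀ i, p i = q (Fin.cast h i)) (x : ι) : postVar κ σ p x = postVar κ σ q x := by
  subst h
  rw [show p = q from funext hpq]

lemma infoGain_congr {m n : ℕ} (h : m = n) {p : Fin m → ι} {q : Fin n → ι}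
    (hpq : ∀ i, p i = q (Fin.cast h i)) : infoGain κ σ p = infoGain κ σ q := by
  subst h
  rw [show p = q from funext hpq]

lemma postVar_append_le (hφ : IsFeatureMap κ φ) (hσ : 0 < σ) (L : List ι) (y x : ι) :
    postVar κ σ (L ++ [y]).get x ≤ postVar κ σ L.get x := by
  rw [postVar_congr (by simp) (get_append_singleton L y)]
  exact postVar_snoc_le hφ hσ _ _ _

lemma infoGain_append (hφ : IsFeatureMap κ φ) (hσ : 0 < σ) (L : List ι) (y : ι) :
    infoGain κ σ (L ++ [y]).get =
      infoGain κ σ L.get + 1 / 2 * Real.log (1 + postVar κ σ L.get y / σ ^ 2) := by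
  rw [infoGain_congr (by simp) (get_append_singleton L y), infoGain_snoc hφ hσ]

lemma infoGain_zero (hφ : IsFeatureMap κ φ) (hσ : 0 < σ) (p : Fin 0 → ι) :
    infoGain κ σ p = 0 := by
  rw [infoGain_eq κ hσ p (kernelMatrix_posSemidef hφ p)]
  simp

lemma infoGain_le_maxInfoGain [Finite ι] {t : ℕ} (p : Fin t → ι) :
    infoGain κ σ p ≤ maxInfoGain κ σ t :=
  le_ciSup (f := fun p : Fin t → ι => infoGain κ σ p) (Set.finite_range _).bddAbove p

lemma infoGain_get_le [Finite ι] {t : ℕ} (L : List ι) (h : L.length = t) :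
    infoGain κ σ L.get ≤ maxInfoGain κ σ t := by
  subst h
  exact infoGain_le_maxInfoGain _

lemma infoGain_le_snoc (hφ : IsFeatureMap κ φ) (hσ : 0 < σ) {n : ℕ} (p : Fin n → ι) (y : ι) :
    infoGain κ σ p ≤ infoGain κ σ (Fin.snoc p y : Fin (n + 1) → ι) := by
  rw [infoGain_snoc hφ hσ]
  have := div_nonneg (postVar_nonneg hφ hσ p y) (sq_nonneg σ)
  have := Real.log_nonneg (x := 1 + postVar κ σ p y / σ ^ 2) (by linarith)
  linarith

lemma monotone_maxInfoGain [Finite ι] [Nonempty ι] (hφ : IsFeatureMap κ φ) (hσ : 0 < σ) :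
    Monotone (maxInfoGain κ σ) := by
  refine monotone_nat_of_le_succ fun n => ciSup_le fun p => ?_
  exact (infoGain_le_snoc hφ hσ p (Classical.arbitrary ι)).trans (infoGain_le_maxInfoGain _)

lemma le_maxInfoGain [Finite ι] [Nonempty ι] (hφ : IsFeatureMap κ φ) (hσ : 0 < σ)
    (h1 : ∀ x, κ x x = 1) {n : ℕ} (hn : 1 ≤ n) :
    1 / 2 * Real.log (1 + 1 / σ ^ 2) ≤ maxInfoGain κ σ n := by
  refine le_trans ?_ (monotone_maxInfoGain hφ hσ hn)
  have x : ι := Classical.arbitrary ι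
  have := infoGain_le_maxInfoGain (κ := κ) (σ := σ)
    (Fin.snoc (Fin.elim0 : Fin 0 → ι) x : Fin (0 + 1) → ι)
  rw [infoGain_snoc hφ hσ, infoGain_zero hφ hσ, postVar_eq, h1] at this
  simpa using this

end Lists

/-- The constant `2 / log (1 + σ⁻²)` that relates posterior variances to the information gain. -/
def varConst (σ : ℝ) : ℝ := 2 / Real.log (1 + 1 / σ ^ 2)

lemma log_one_add_inv_sq_pos {σ : ℝ} (hσ : 0 < σ) : 0 < Real.log (1 + 1 / σ ^ 2) :=
  Real.log_pos (by have : 0 < 1 / σ ^ 2 := by positivity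
                   linarith)

lemma varConst_pos {σ : ℝ} (hσ : 0 < σ) : 0 < varConst σ :=
  div_pos two_pos (log_one_add_inv_sq_pos hσ)

/-- Bernoulli's inequality `(1 + σ⁻²) ^ s ≤ 1 + s σ⁻²`, in logarithmic form. -/
lemma le_varConst_mul_log {σ s : ℝ} (hσ : 0 < σ) (hs0 : 0 ≤ s) (hs1 : s ≤ 1) :
    s ≤ varConst σ * (1 / 2 * Real.log (1 + s / σ ^ 2)) := by
  have hl := log_one_add_inv_sq_pos hσ
  have hp : 0 < 1 / σ ^ 2 := by positivity
  have h1 : (1 + 1 / σ ^ 2) ^ s ≤ 1 + s * (1 / σ ^ 2) :=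
    rpow_one_add_le_one_add_mul_self (by linarith) hs0 hs1
  have h2 := Real.log_le_log (by positivity) h1
  rw [Real.log_rpow (by positivity), mul_one_div] at h2
  rw [varConst, div_mul_eq_mul_div, le_div_iff₀ hl]
  linarith

namespace RobustInstance

variable {d : ℕ} {k : EuclideanSpace ℝ (Fin d) → EuclideanSpace ℝ (Fin d) → ℝ}
  (I : RobustInstance d k) {H : Type} [NormedAddCommGroup H] [InnerProductSpace ℝ H]
  {φ : I.X → H} {σ : ℝ} {sel : ℕ → Finset I.X → List I.X → I.X × I.X}

lemma nonempty_X : Nonempty I.X := I.nonempty.to_subtype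

/-- The function of a robust instance is represented in a feature space of the kernel. -/
lemma exists_featureMap : ∃ (H : Type) (_ : NormedAddCommGroup H) (_ : InnerProductSpace ℝ H)
    (φ : I.X → H) (g : H), IsFeatureMap I.κ φ ∧ (∀ x, I.f x = inner ℝ g (φ x)) ∧ ‖g‖ ≤ I.Ψ := by
  obtain ⟨H, i1, i2, i3, i4, hk, g, hg, hn⟩ := I.norm_le
  refine ⟨H, i1, i2, fun x => RKHS.kerFun H x 1, g, fun x y => ?_, fun x => ?_, hn⟩
  · rw [RKHS.kerFun_inner, RKHS.kerFun_apply, hk]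
    simp [κ]
  · rw [RKHS.inner_kerFun, hg]
    simp

lemma length_queries (i : ℕ) (A : Finset I.X) (n : ℕ) :
    (I.queries sel i A n).length = n := by
  induction n with
  | zero => rfl
  | succ n ih => simp [queries, ih]

lemma antitone_postVar_queries (hφ : IsFeatureMap I.κ φ) (hσ : 0 < σ) (i : ℕ) (A : Finset I.X)
    (x : I.X) : Antitone fun n => postVar I.κ σ (I.queries sel i A n).get x :=
  antitone_nat_of_succ_le fun _ => postVar_append_le hφ hσ _ _ _

lemma infoGain_queries (hφ : IsFeatureMap I.κ φ) (hσ : 0 < σ) (i : ℕ) (A : Finset I.X) (n : ℕ) :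
    infoGain I.κ σ (I.queries sel i A n).get =
      ∑ j ∈ Finset.range n, 1 / 2 * Real.log (1 + postVar I.κ σ (I.queries sel i A j).get
        (sel i A (I.queries sel i A j)).2 / σ ^ 2) := by
  induction n with
  | zero => exact infoGain_zero hφ hσ _
  | succ n ih => rw [Finset.sum_range_succ, ← ih]; exact infoGain_append hφ hσ _ _

/-- After `n` maximum variance queries the posterior variance at every perturbed point of every
candidate is at most a constant times `γ_n / n`. -/
lemma mul_postVar_queries_le (hφ : IsFeatureMap I.κ φ) (hσ : 0 < σ) (h1 : ∀ x, I.κ x x = 1)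
    (hsel : I.IsMaxVarianceRule σ sel) (i : ℕ) {A : Finset I.X} (n : ℕ)
    {x x' : I.X} (hx : x ∈ A) (hx' : I.D x x' ≤ I.ξ) :
    n * postVar I.κ σ (I.queries sel i A n).get x' ≤ varConst σ * I.gam σ n := by
  have hj : ∀ j ∈ Finset.range n, postVar I.κ σ (I.queries sel i A n).get x' ≤
      varConst σ * (1 / 2 * Real.log (1 + postVar I.κ σ (I.queries sel i A j).get
        (sel i A (I.queries sel i A j)).2 / σ ^ 2)) := by
    intro j hj
    have hs := (hsel i A (I.queries sel i A j) ⟨x, hx⟩).2.2 x hx x' hx'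
    rw [postStd, postStd, Real.sqrt_le_sqrt_iff (postVar_nonneg hφ hσ _ _)] at hs
    refine (I.antitone_postVar_queries hφ hσ i A x' (Finset.mem_range.1 hj).le).trans
      (hs.trans (le_varConst_mul_log hσ (postVar_nonneg hφ hσ _ _) ?_))
    exact (postVar_le_diag hφ hσ _ _).trans_eq (h1 _)
  have hsum := Finset.sum_le_sum hj
  rw [Finset.sum_const, Finset.card_range, nsmul_eq_mul, ← Finset.mul_sum,
    ← I.infoGain_queries hφ hσ] at hsum
  exact hsum.trans (mul_le_mul_of_nonneg_left (infoGain_get_le _ (I.length_queries i A n))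
    (varConst_pos hσ).le)

end RobustInstance

/-! ### Gaussian tails -/

/-- Translating a set away from the origin by `s` costs the standard Gaussian measure a factor
`exp (-s² / 2)`. -/
lemma gaussianReal_shift_le {s : ℝ} {A A' : Set ℝ} (hA : MeasurableSet A) (hA' : MeasurableSet A')
    (h : ∀ x, x + s ∈ A → x ∈ A' ∧ 0 ≤ x * s) :
    gaussianReal 0 1 A ≤ ENNReal.ofReal (Real.exp (-s ^ 2 / 2)) * gaussianReal 0 1 A' := by
  rw [gaussianReal_apply 0 one_ne_zero, gaussianReal_apply 0 one_ne_zero,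
    ← lintegral_indicator hA, ← lintegral_indicator hA', ← lintegral_const_mul _
      ((measurable_gaussianPDF 0 1).indicator hA'),
    ← lintegral_add_right_eq_self (fun x => A.indicator (gaussianPDF 0 1) x) s]
  refine lintegral_mono fun x => ?_
  by_cases hx : x + s ∈ A
  · obtain ⟨h1, h2⟩ := h x hx
    rw [Set.indicator_of_mem hx, Set.indicator_of_mem h1, gaussianPDF, gaussianPDF,
      ← ENNReal.ofReal_mul (Real.exp_pos _).le]
    refine ENNReal.ofReal_le_ofReal ?_
    rw [gaussianPDFReal, gaussianPDFReal, mul_left_comm, ← Real.exp_add]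
    refine mul_le_mul_of_nonneg_left (Real.exp_le_exp.2 ?_) (by positivity)
    simp only [NNReal.coe_one]
    nlinarith
  · rw [Set.indicator_of_notMem hx]
    exact zero_le

/-- The two-sided Gaussian tail bound without a factor `2`. -/
lemma gaussianReal_abs_gt_le {u : ℝ} (hu : 0 ≤ u) :
    gaussianReal 0 1 {x | u < |x|} ≤ ENNReal.ofReal (Real.exp (-u ^ 2 / 2)) := by
  have hset : {x : ℝ | u < |x|} = Set.Ioi u ∪ Set.Iio (-u) := by
    ext x
    simp [lt_abs, lt_neg]
  have h1 := gaussianReal_shift_le (s := u) (A := Set.Ioi u) (A' := Set.Ioi 0) measurableSet_Ioi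
    measurableSet_Ioi (fun x hx => by
      have : 0 < x := by simpa using hx
      exact ⟨this, by positivity⟩)
  have h2 := gaussianReal_shift_le (s := -u) (A := Set.Iio (-u)) (A' := Set.Iio 0)
    measurableSet_Iio measurableSet_Iio (fun x hx => by
      have : x < 0 := by simpa using hx
      exact ⟨this, by nlinarith⟩)
  rw [neg_sq] at h2
  have h3 : gaussianReal 0 1 (Set.Ioi 0) + gaussianReal 0 1 (Set.Iio 0) ≤ 1 := by
    rw [← measure_union (by
      exact Set.disjoint_left.2 fun x hx hx' => lt_asymm (Set.mem_Ioi.1 hx) hx') measurableSet_Iio]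
    exact prob_le_one
  calc gaussianReal 0 1 {x | u < |x|} ≤ _ := by rw [hset]; exact measure_union_le _ _
    _ ≤ _ := add_le_add h1 h2
    _ = ENNReal.ofReal (Real.exp (-u ^ 2 / 2)) *
        (gaussianReal 0 1 (Set.Ioi 0) + gaussianReal 0 1 (Set.Iio 0)) := by rw [mul_add]
    _ ≤ _ := mul_le_of_le_one_right' h3

section LinearCombinations

variable {Ω : Type*} [MeasurableSpace Ω] {μ : Measure Ω}

lemma hasLaw_sum_mul_gaussian {n : ℕ} {X : Fin n → Ω → ℝ} {v : NNReal}
    (hX : ∀ j, HasLaw (X j) (gaussianReal 0 v) μ) (hind : iIndepFun X μ) (w : Fin n → ℝ) :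
    HasLaw (fun ω => ∑ j, w j * X j ω) (gaussianReal 0 (v * (∑ j, w j ^ 2).toNNReal)) μ := by
  have hl : ∀ j, HasLaw (fun ω => w j * X j ω)
      (gaussianReal (w j * 0) (.mk (w j ^ 2) (sq_nonneg _) * v)) μ :=
    fun j => gaussianReal_const_mul (hX j) (w j)
  have hg : ∀ j, HasGaussianLaw (fun ω => w j * X j ω) μ := fun j => (hl j).hasGaussianLaw
  have hi : iIndepFun (fun j ω => w j * X j ω) μ :=
    hind.comp (fun j x => w j * x) (fun j => by fun_prop)
  have hs : HasGaussianLaw (fun ω => ∑ j, w j * X j ω) μ := iIndepFun.hasGaussianLaw_fun_sum hg hi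
  have hmean : ∫ ω, (∑ j, w j * X j ω) ∂μ = 0 := by
    rw [integral_finsetSum _ fun j _ => (hg j).integrable]
    refine Finset.sum_eq_zero fun j _ => ?_
    rw [(hl j).integral_eq]
    simp
  have hvar : Var[fun ω => ∑ j, w j * X j ω; μ] = v * ∑ j, w j ^ 2 := by
    have : (fun ω => ∑ j, w j * X j ω) = ∑ j, fun ω => w j * X j ω := by ext; simp
    rw [this, IndepFun.variance_sum (fun j _ => (hg j).memLp_two)
      (fun i _ j _ hij => hi.indepFun hij), Finset.mul_sum]
    refine Finset.sum_congr rfl fun j _ => ?_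
    rw [(hl j).variance_eq, variance_id_gaussianReal]
    simp [mul_comm]
  refine ⟨hs.aemeasurable, ?_⟩
  rw [hs.map_eq_gaussianReal, hmean, hvar, Real.toNNReal_mul v.coe_nonneg, Real.toNNReal_coe]

lemma measure_abs_sum_mul_gaussian_gt_le [IsProbabilityMeasure μ] {n : ℕ} {X : Fin n → Ω → ℝ} {σ u : ℝ} (hσ : 0 < σ)
    (hX : ∀ j, HasLaw (X j) (gaussianReal 0 (σ ^ 2).toNNReal) μ) (hind : iIndepFun X μ)
    (w : Fin n → ℝ) (hu : 0 ≤ u) :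
    μ {ω | σ * √(∑ j, w j ^ 2) * u < |∑ j, w j * X j ω|} ≤
      ENNReal.ofReal (Real.exp (-u ^ 2 / 2)) := by
  have hlaw := hasLaw_sum_mul_gaussian hX hind w
  have hw : 0 ≤ ∑ j, w j ^ 2 := Finset.sum_nonneg fun _ _ => sq_nonneg _
  rcases hw.eq_or_lt with h0 | h0
  · rw [← h0] at hlaw ⊢
    rw [Real.toNNReal_zero, mul_zero, gaussianReal_zero_var] at hlaw
    have : ∀ j, w j = 0 := fun j => by
      have := (Finset.sum_eq_zero_iff_of_nonneg (fun j _ => sq_nonneg (w j))).1 h0.symm j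
        (Finset.mem_univ _)
      simpa using this
    simp [this]
  · set s := σ * √(∑ j, w j ^ 2) with hs
    have hs0 : 0 < s := by positivity
    have hdiv := gaussianReal_div_const hlaw s
    have hv : (σ ^ 2).toNNReal * (∑ j, w j ^ 2).toNNReal / NNReal.mk (s ^ 2) (sq_nonneg s) = 1 := by
      ext
      simp only [NNReal.coe_div, NNReal.coe_mul, NNReal.coe_mk, NNReal.coe_one,
        Real.coe_toNNReal _ hw, Real.coe_toNNReal _ (sq_nonneg σ)]
      rw [hs, mul_pow, Real.sq_sqrt hw, div_self (by positivity)]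
    have hset : {ω | s * u < |∑ j, w j * X j ω|} =
        (fun ω => (∑ j, w j * X j ω) / s) ⁻¹' {x | u < |x|} := by
      ext ω
      simp only [Set.mem_ofPred_eq, Set.mem_preimage, abs_div, abs_of_pos hs0, lt_div_iff₀ hs0,
        mul_comm u]
    rw [hset, ← Measure.map_apply_of_aemeasurable hdiv.aemeasurable
      (measurableSet_lt (g := fun x : ℝ => |x|) measurable_const (by fun_prop)), hdiv.map_eq]
    rw [zero_div, hv]
    exact gaussianReal_abs_gt_le hu

end LinearCombinations

/-! ### Confidence intervals of all batches -/

lemma batchEnd_succ (a : ℝ) (T i : ℕ) :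
    batchEnd a T (i + 1) = batchEnd a T i + batchSize a T (i + 1) := rfl

lemma batchEnd_le (a : ℝ) (T i : ℕ) : batchEnd a T i ≤ T := by
  induction i with
  | zero => exact Nat.zero_le _
  | succ i ih =>
    rw [batchEnd]
    have := min_le_right ⌈(T : ℝ) ^ (1 - a ^ (i + 1))⌉₊ (T - batchEnd a T i)
    omega

lemma monotone_batchEnd (a : ℝ) (T : ℕ) : Monotone (batchEnd a T) :=
  monotone_nat_of_le_succ fun i => by rw [batchEnd_succ]; exact Nat.le_add_right _ _

/-- The law of total probability in the form used for conditioning: if each `F i` is independent of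
the cell `E i` and has measure at most `c`, so has the event that is `F i` on the cell `E i`. -/
lemma measure_iUnion_inter_le {Ω α : Type*} [MeasurableSpace Ω] [Fintype α] {μ : Measure Ω}
    [IsProbabilityMeasure μ] {E F : α → Set Ω} {c : ENNReal} (hE : ∀ i, MeasurableSet (E i))
    (hd : Pairwise (Function.onFun Disjoint E))
    (hi : ∀ i, μ (E i ∩ F i) = μ (E i) * μ (F i)) (hF : ∀ i, μ (F i) ≤ c) :
    μ (⋃ i, E i ∩ F i) ≤ c := by
  calc μ (⋃ i, E i ∩ F i) ≤ ∑ i, μ (E i ∩ F i) := measure_iUnion_fintype_le _ _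
    _ ≤ ∑ i, μ (E i) * c := Finset.sum_le_sum fun i _ => by rw [hi]; gcongr; exact hF i
    _ = (∑ i, μ (E i)) * c := by rw [Finset.sum_mul]
    _ = μ (⋃ i, E i) * c := by rw [measure_iUnion hd hE, tsum_fintype]
    _ ≤ c := mul_le_of_le_one_left' prob_le_one

namespace RobustInstance

variable {d : ℕ} {k : EuclideanSpace ℝ (Fin d) → EuclideanSpace ℝ (Fin d) → ℝ}
  (I : RobustInstance d k) {σ : ℝ} {sel : ℕ → Finset I.X → List I.X → I.X × I.X}

section Measurability

variable {Ω : Type*} [MeasurableSpace Ω] {w : Ω → ℕ → ℝ}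

lemma measurable_batchMean (L : List I.X) (s : ℕ) (x : I.X)
    (hw : ∀ j < L.length, Measurable fun ω => w ω (s + j + 1)) :
    Measurable fun ω => I.batchMean σ L s (w ω) x := by
  unfold batchMean postMean
  simp only [dotProduct, Matrix.mulVec]
  refine Finset.measurable_sum _ fun i _ => Measurable.const_mul ?_ _
  refine Finset.measurable_sum _ fun j _ => Measurable.const_mul ?_ _
  exact (hw j j.2).const_add _

lemma measurable_worst {g : Ω → I.X → ℝ} (hg : ∀ x, Measurable fun ω => g ω x) (x : I.X) :
    Measurable fun ω => I.worst (g ω) x :=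
  Measurable.iInf fun x' => hg x'

lemma measurableSet_eliminate_eq (b : ℝ) (A : Finset I.X) (L : List I.X) (s : ℕ)
    (hw : ∀ j < L.length, Measurable fun ω => w ω (s + j + 1)) (A' : Finset I.X) :
    MeasurableSet {ω | I.eliminate σ b A L s (w ω) = A'} := by
  have hm := fun x => I.measurable_batchMean (σ := σ) L s x hw
  have hset : {ω | I.eliminate σ b A L s (w ω) = A'} = ⋂ x, {ω | (x ∈ A ∧ ∀ x' ∈ A,
      I.worst (I.lcb σ b L s (w ω)) x' ≤ I.worst (I.ucb σ b L s (w ω)) x) ↔ x ∈ A'} := by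
    ext ω
    simp [eliminate, Finset.ext_iff]
  rw [hset]
  refine MeasurableSet.iInter fun x => ?_
  have h1 : MeasurableSet {ω | x ∈ A ∧ ∀ x' ∈ A,
      I.worst (I.lcb σ b L s (w ω)) x' ≤ I.worst (I.ucb σ b L s (w ω)) x} := by
    have hinter : {ω | x ∈ A ∧ ∀ x' ∈ A,
        I.worst (I.lcb σ b L s (w ω)) x' ≤ I.worst (I.ucb σ b L s (w ω)) x} =
        {_ω | x ∈ A} ∩ ⋂ x', ⋂ (_ : x' ∈ A), {ω |
          I.worst (I.lcb σ b L s (w ω)) x' ≤ I.worst (I.ucb σ b L s (w ω)) x} := by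
      ext ω
      simp only [Set.mem_ofPred_eq, Set.mem_inter_iff, Set.mem_iInter]
    rw [hinter]
    refine (MeasurableSet.const _).inter
      (MeasurableSet.iInter fun x' => MeasurableSet.iInter fun _ => measurableSet_le ?_ ?_)
    · exact I.measurable_worst (fun y => (hm y).sub_const _) x'
    · exact I.measurable_worst (fun y => (hm y).add_const _) x
  by_cases hx : x ∈ A'
  · simpa only [hx, iff_true] using h1
  · simp only [hx, iff_false]
    exact h1.compl

/-- The candidates after `i` batches are determined by the noise up to the end of batch `i`. -/
lemma measurableSet_active_eq (a : ℝ) (T : ℕ) (δ : ℝ) (i : ℕ)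
    (hw : ∀ t, 1 ≤ t → t ≤ batchEnd a T i → Measurable fun ω => w ω t) (A : Finset I.X) :
    MeasurableSet {ω | I.active σ a T δ sel (w ω) i = A} := by
  induction i generalizing A with
  | zero => exact MeasurableSet.const (Finset.univ = A)
  | succ i ih =>
    have ih' := ih fun t h1 h2 => hw t h1 (h2.trans (monotone_batchEnd a T i.le_succ))
    have hset : {ω | I.active σ a T δ sel (w ω) (i + 1) = A} =
        ⋃ A', {ω | I.active σ a T δ sel (w ω) i = A'} ∩
          {ω | I.eliminate σ (I.sqrtBeta δ (numBatches a T)) A'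
            (I.queries sel (i + 1) A' (batchSize a T (i + 1))) (batchEnd a T i) (w ω) = A} := by
      ext ω
      simp [active]
    rw [hset]
    refine MeasurableSet.iUnion fun A' => (ih' A').inter ?_
    refine I.measurableSet_eliminate_eq _ _ _ _ (fun j hj => hw _ (by omega) ?_) _
    rw [I.length_queries] at hj
    rw [batchEnd_succ]
    omega

end Measurability

section Confidence

variable {Ω : Type*} [MeasurableSpace Ω] {μ : Measure Ω} [IsProbabilityMeasure μ]
  {z : ℕ → Ω → ℝ} {T : ℕ}

lemma one_le_card_mul_div {B : ℕ} (hB : 1 ≤ B) {δ : ℝ} (hδ : 0 < δ) (hδ1 : δ < 1) :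
    1 ≤ (I.X.card : ℝ) * B / δ := by
  have h1 : (1 : ℝ) ≤ I.X.card := by exact_mod_cast I.nonempty.card_pos
  have h2 : (1 : ℝ) ≤ B := by exact_mod_cast hB
  rw [le_div_iff₀ hδ]
  nlinarith

/-- The confidence intervals of a batch whose queries are fixed in advance. -/
lemma measure_exists_batchMean_far_le (hσ : 0 < σ) (hz : IsGaussianNoise σ T μ z) (L : List I.X)
    (s : ℕ) (hs : s + L.length ≤ T) {B : ℕ} (hB : 1 ≤ B) {δ : ℝ} (hδ : 0 < δ) (hδ1 : δ < 1) :
    μ {ω | ∃ x, I.sqrtBeta δ B * postStd I.κ σ L x <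
      |I.f x - I.batchMean σ L s (fun t => z t ω) x|} ≤ ENNReal.ofReal (δ / B) := by
  obtain ⟨H, _, _, φ, g, hφ, hg, hgΨ⟩ := I.exists_featureMap
  have hq := I.one_le_card_mul_div hB hδ hδ1
  have hB0 : (0 : ℝ) < B := by exact_mod_cast hB
  have hc0 : (0 : ℝ) < I.X.card := by exact_mod_cast I.nonempty.card_pos
  set q := (I.X.card : ℝ) * B / δ with hqdef
  set u := √(2 * Real.log q) with hu
  have hu0 : 0 ≤ u := Real.sqrt_nonneg _
  have hexp : Real.exp (-u ^ 2 / 2) = δ / (I.X.card * B) := by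
    rw [hu, Real.sq_sqrt (by have := Real.log_nonneg hq; positivity), neg_div,
      mul_div_cancel_left₀ _ two_ne_zero, Real.exp_neg, Real.exp_log (by linarith), hqdef, inv_div]
  have hmem : ∀ j : Fin L.length, s + j + 1 ∈ Finset.Icc 1 T := fun j =>
    Finset.mem_Icc.2 ⟨by omega, by have := j.2; omega⟩
  have hind : iIndepFun (fun (j : Fin L.length) => z (s + j + 1)) μ := by
    have := hz.2.2.precomp (g := fun j : Fin L.length => (⟨s + j + 1, hmem j⟩ : Finset.Icc 1 T))
      (fun i j hij => by
        have := congrArg Subtype.val hij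
        simp only at this
        exact Fin.ext (by omega))
    exact this
  have hx : ∀ x : I.X, μ {ω | I.sqrtBeta δ B * postStd I.κ σ L x <
      |I.f x - I.batchMean σ L s (fun t => z t ω) x|} ≤ ENNReal.ofReal (δ / (I.X.card * B)) := by
    intro x
    set W := postWeights I.κ σ L.get x with hW
    rw [← hexp]
    refine le_trans (measure_mono fun ω hω => ?_) (measure_abs_sum_mul_gaussian_gt_le hσ
      (fun j : Fin L.length => hz.2.1 _ (hmem j)) hind W hu0)
    simp only [Set.mem_ofPred_eq] at hω ⊢
    by_contra! hle
    have hdev := abs_sub_postMean_le hφ hσ hg L.get (fun j => z (s + j + 1) ω) x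
    rw [← hW] at hdev
    have hvar := postVar_eq_ridge hφ hσ L.get x
    rw [ridge, ← hW] at hvar
    set h := ‖φ x - ∑ i, W i • φ (L.get i)‖
    have hW0 : 0 ≤ ∑ j, W j ^ 2 := Finset.sum_nonneg fun _ _ => sq_nonneg _
    -- bias `h` and noise level are both at most the posterior deviation: `h² + τ²` is its square
    have h1 : h ≤ postStd I.κ σ L x :=
      Real.le_sqrt_of_sq_le (by rw [hvar]; nlinarith [sq_nonneg σ])
    have h2 : σ * √(∑ j, W j ^ 2) ≤ postStd I.κ σ L x :=
      Real.le_sqrt_of_sq_le (by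
        rw [hvar, mul_pow, Real.sq_sqrt hW0]; nlinarith [sq_nonneg h])
    have h3 : ‖g‖ * h ≤ I.Ψ * postStd I.κ σ L x :=
      mul_le_mul hgΨ h1 (norm_nonneg _) I.Ψ_pos.le
    have h4 := mul_le_mul_of_nonneg_right h2 hu0
    have h5 : I.sqrtBeta δ B = I.Ψ + u := rfl
    rw [h5] at hω
    have : |I.f x - I.batchMean σ L s (fun t => z t ω) x| ≤ I.Ψ * postStd I.κ σ L x +
      postStd I.κ σ L x * u := hdev.trans (by linarith)
    linarith
  have hset : {ω | ∃ x, I.sqrtBeta δ B * postStd I.κ σ L x <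
      |I.f x - I.batchMean σ L s (fun t => z t ω) x|} =
      ⋃ x, {ω | I.sqrtBeta δ B * postStd I.κ σ L x <
        |I.f x - I.batchMean σ L s (fun t => z t ω) x|} := by
    ext ω; simp
  rw [hset]
  refine (measure_iUnion_fintype_le _ _).trans ((Finset.sum_le_sum fun x _ => hx x).trans ?_)
  rw [Finset.sum_const, nsmul_eq_mul, Finset.card_univ, Fintype.card_coe,
    ← ENNReal.ofReal_natCast, ← ENNReal.ofReal_mul hc0.le]
  refine ENNReal.ofReal_le_ofReal (le_of_eq ?_)
  field_simp

/-- The confidence intervals of all batches hold on the noise path `w`. -/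
def ConfidenceHolds (σ a : ℝ) (T : ℕ) (δ : ℝ)
    (sel : ℕ → Finset I.X → List I.X → I.X × I.X) (w : ℕ → ℝ) : Prop :=
  ∀ i < numBatches a T, ∀ x,
    |I.f x - I.batchMean σ (I.queries sel (i + 1) (I.active σ a T δ sel w i)
        (batchSize a T (i + 1))) (batchEnd a T i) w x| ≤
      I.sqrtBeta δ (numBatches a T) * postStd I.κ σ
        (I.queries sel (i + 1) (I.active σ a T δ sel w i) (batchSize a T (i + 1))) x

/-- The queries of a batch depend only on the noise of earlier batches, which is independent of the
noise of the batch; so the bound for fixed queries carries over. -/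
lemma measure_batch_fails_le (hσ : 0 < σ) (hz : IsGaussianNoise σ T μ z) (a : ℝ) (i : ℕ) {B : ℕ}
    (hB : 1 ≤ B) {δ : ℝ} (hδ : 0 < δ) (hδ1 : δ < 1) :
    μ {ω | ∃ x, I.sqrtBeta δ B * postStd I.κ σ (I.queries sel (i + 1)
          (I.active σ a T δ sel (fun t => z t ω) i) (batchSize a T (i + 1))) x <
        |I.f x - I.batchMean σ (I.queries sel (i + 1) (I.active σ a T δ sel (fun t => z t ω) i)
          (batchSize a T (i + 1))) (batchEnd a T i) (fun t => z t ω) x|} ≤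
      ENNReal.ofReal (δ / B) := by
  have hend : batchEnd a T i + batchSize a T (i + 1) ≤ T := by
    rw [← batchEnd_succ]; exact batchEnd_le a T (i + 1)
  set Q : Finset I.X → List I.X := fun A => I.queries sel (i + 1) A (batchSize a T (i + 1)) with hQ
  set E : Finset I.X → Set Ω := fun A => {ω | I.active σ a T δ sel (fun t => z t ω) i = A} with hE
  set F : Finset I.X → Set Ω := fun A => {ω | ∃ x, I.sqrtBeta δ B * postStd I.κ σ (Q A) x <
    |I.f x - I.batchMean σ (Q A) (batchEnd a T i) (fun t => z t ω) x|} with hF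
  have hQlen : ∀ A, (Q A).length = batchSize a T (i + 1) := fun A => I.length_queries _ _ _
  let m : Finset.Icc 1 T → MeasurableSpace Ω := fun t => MeasurableSpace.comap (z t) inferInstance
  have hle : ∀ t, m t ≤ ‹MeasurableSpace Ω› := fun t => (hz.1 t t.2).comap_le
  have hindep : iIndep m μ := hz.2.2
  let S : Set (Finset.Icc 1 T) := {t | (t : ℕ) ≤ batchEnd a T i}
  have hI := indep_iSup_of_disjoint hle hindep (disjoint_compl_right (a := S))
  have hzm : ∀ (R : Set (Finset.Icc 1 T)) (t : Finset.Icc 1 T), t ∈ R →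
      Measurable[⨆ t ∈ R, m t] (z t) := fun R t ht =>
    (comap_measurable (z t)).mono (le_biSup m ht) le_rfl
  have hEm : ∀ A, MeasurableSet[⨆ t ∈ S, m t] (E A) := fun A =>
    @measurableSet_active_eq d k I σ sel Ω (⨆ t ∈ S, m t) (fun ω t => z t ω) a T δ i
      (fun t h1 h2 => hzm S ⟨t, Finset.mem_Icc.2 ⟨h1, h2.trans (batchEnd_le a T i)⟩⟩ h2) A
  have hFm : ∀ A, MeasurableSet[⨆ t ∈ Sᶜ, m t] (F A) := by
    intro A
    let _ : MeasurableSpace Ω := ⨆ t ∈ Sᶜ, m t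
    have hFA : F A = ⋃ x, {ω | I.sqrtBeta δ B * postStd I.κ σ (Q A) x <
        |I.f x - I.batchMean σ (Q A) (batchEnd a T i) (fun t => z t ω) x|} := by
      ext ω; simp [F]
    rw [hFA]
    refine MeasurableSet.iUnion fun x => measurableSet_lt measurable_const ?_
    have hm : Measurable fun ω => I.batchMean σ (Q A) (batchEnd a T i) (fun t => z t ω) x := by
      refine I.measurable_batchMean (w := fun ω t => z t ω) _ _ _ fun j hj => ?_
      rw [hQlen] at hj
      refine hzm Sᶜ ⟨batchEnd a T i + j + 1, Finset.mem_Icc.2 ⟨by omega, by omega⟩⟩ ?_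
      simp only [S, Set.mem_compl_iff, Set.mem_ofPred_eq]
      omega
    exact (hm.const_sub _).abs
  have hsub : {ω | ∃ x, I.sqrtBeta δ B * postStd I.κ σ (I.queries sel (i + 1)
          (I.active σ a T δ sel (fun t => z t ω) i) (batchSize a T (i + 1))) x <
        |I.f x - I.batchMean σ (I.queries sel (i + 1) (I.active σ a T δ sel (fun t => z t ω) i)
          (batchSize a T (i + 1))) (batchEnd a T i) (fun t => z t ω) x|} ⊆ ⋃ A, E A ∩ F A := by
    intro ω hω
    rw [Set.mem_iUnion]
    refine ⟨I.active σ a T δ sel (fun t => z t ω) i, ?_, ?_⟩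
    · simp only [hE, Set.mem_ofPred_eq]
    · simp only [hF, hQ, Set.mem_ofPred_eq] at hω ⊢
      exact hω
  refine (measure_mono hsub).trans (measure_iUnion_inter_le ?_ ?_ ?_ ?_)
  · exact fun A => iSup₂_le (fun t _ => hle t) _ (hEm A)
  · intro A A' hAA'
    refine Set.disjoint_left.2 fun ω h1 h2 => hAA' ?_
    exact Eq.trans (Eq.symm h1) h2
  · exact fun A => (Indep_iff _ _ μ).1 hI _ _ (hEm A) (hFm A)
  · exact fun A => I.measure_exists_batchMean_far_le hσ hz (Q A) _ (by rw [hQlen]; exact hend)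
      hB hδ hδ1

/-- Any event that contains the paths with valid confidence intervals has measure at least `1 - δ`;
it need not be measurable. -/
lemma le_measure_confidenceHolds (hσ : 0 < σ) (hz : IsGaussianNoise σ T μ z) (a : ℝ)
    (hB : 1 ≤ numBatches a T) {δ : ℝ} (hδ : 0 < δ) (hδ1 : δ < 1) {S : Set Ω}
    (hS : ∀ ω, I.ConfidenceHolds σ a T δ sel (fun t => z t ω) → ω ∈ S) :
    ENNReal.ofReal (1 - δ) ≤ μ S := by
  set B := numBatches a T with hBdef
  have hB0 : (0 : ℝ) < B := by exact_mod_cast hB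
  have hc : μ Sᶜ ≤ ENNReal.ofReal δ := by
    have hsub : Sᶜ ⊆ ⋃ i ∈ Finset.range B, {ω | ∃ x, I.sqrtBeta δ B * postStd I.κ σ
          (I.queries sel (i + 1) (I.active σ a T δ sel (fun t => z t ω) i)
            (batchSize a T (i + 1))) x <
        |I.f x - I.batchMean σ (I.queries sel (i + 1) (I.active σ a T δ sel (fun t => z t ω) i)
          (batchSize a T (i + 1))) (batchEnd a T i) (fun t => z t ω) x|} := by
      intro ω hω
      have hn : ¬ I.ConfidenceHolds σ a T δ sel (fun t => z t ω) := fun h => hω (hS ω h)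
      unfold ConfidenceHolds at hn
      push Not at hn
      obtain ⟨i, hi, x, hx⟩ := hn
      exact Set.mem_biUnion (Finset.mem_coe.2 (Finset.mem_range.2 hi)) ⟨x, hx⟩
    refine (measure_mono hsub).trans ((measure_biUnion_finset_le _ _).trans
      ((Finset.sum_le_sum fun i _ => I.measure_batch_fails_le hσ hz a i hB hδ hδ1).trans ?_))
    rw [Finset.sum_const, Finset.card_range, nsmul_eq_mul, ← ENNReal.ofReal_natCast,
      ← ENNReal.ofReal_mul hB0.le, mul_div_cancel₀ _ hB0.ne']
  have h1 : 1 ≤ μ S + μ Sᶜ := by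
    rw [← measure_univ (μ := μ), ← Set.union_compl_self S]
    exact measure_union_le _ _
  rw [ENNReal.ofReal_sub _ hδ.le, ENNReal.ofReal_one]
  exact tsub_le_iff_right.2 (h1.trans (add_le_add le_rfl hc))

end Confidence

end RobustInstance

/-! ### Regret on a path where the confidence intervals hold -/

section BatchIndices

variable {a : ℝ} {T : ℕ}

/-- Every batch advances the time by at least one until the horizon is reached. -/
lemma min_le_batchEnd (hT : 1 ≤ T) (n : ℕ) : min n T ≤ batchEnd a T n := by
  induction n with
  | zero => simp
  | succ n ih =>
    have h1 : 1 ≤ ⌈(T : ℝ) ^ (1 - a ^ (n + 1))⌉₊ :=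
      Nat.one_le_ceil_iff.2 (Real.rpow_pos_of_pos (by exact_mod_cast hT) _)
    have h2 := batchEnd_le a T n
    rw [batchEnd]
    omega

lemma batchEnd_numBatches (hT : 1 ≤ T) : batchEnd a T (numBatches a T) = T := by
  have hne : {B | batchEnd a T B = T}.Nonempty :=
    ⟨T, le_antisymm (batchEnd_le a T T) (by simpa using min_le_batchEnd (a := a) hT T)⟩
  exact Nat.sInf_mem hne

lemma batchEnd_lt {i : ℕ} (hi : i < numBatches a T) : batchEnd a T i < T :=
  lt_of_le_of_ne (batchEnd_le a T i) fun h => Nat.notMem_of_lt_sInf hi h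

lemma batchSize_eq_ceil {i : ℕ} (hi : i + 1 < numBatches a T) :
    batchSize a T (i + 1) = ⌈(T : ℝ) ^ (1 - a ^ (i + 1))⌉₊ := by
  have h := batchEnd_lt hi
  rw [batchEnd_succ] at h
  rw [batchSize, Nat.add_sub_cancel] at h ⊢
  omega

lemma batchSize_le_ceil (i : ℕ) :
    batchSize a T (i + 1) ≤ ⌈(T : ℝ) ^ (1 - a ^ (i + 1))⌉₊ := min_le_left _ _

lemma batchIndex_eq {i t : ℕ} (h1 : batchEnd a T i < t) (h2 : t ≤ batchEnd a T (i + 1)) :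
    batchIndex a T t = i + 1 := by
  refine le_antisymm (Nat.sInf_le h2) (le_csInf ⟨_, h2⟩ fun j hj => ?_)
  by_contra! hlt
  have := monotone_batchEnd a T (Nat.lt_succ_iff.1 hlt)
  have hj' : t ≤ batchEnd a T j := hj
  omega

lemma sum_Icc_batchEnd_le {F ρ : ℕ → ℝ} (n : ℕ)
    (h : ∀ i < n, ∀ t, batchEnd a T i < t → t ≤ batchEnd a T (i + 1) → F t ≤ ρ i) :
    ∑ t ∈ Finset.Icc 1 (batchEnd a T n), F t ≤
      ∑ i ∈ Finset.range n, batchSize a T (i + 1) * ρ i := by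
  have hIcc : ∀ m, Finset.Icc 1 m = Finset.Ioc 0 m := fun m => rfl
  rw [hIcc]
  induction n with
  | zero => simp [batchEnd]
  | succ n ih =>
    rw [Finset.sum_range_succ, ← Finset.sum_Ioc_consecutive F (Nat.zero_le _)
      (monotone_batchEnd a T n.le_succ)]
    refine add_le_add (ih fun i hi => h i (hi.trans n.lt_succ_self)) ?_
    refine (Finset.sum_le_card_nsmul _ _ (ρ n) fun t ht => ?_).trans_eq ?_
    · rw [Finset.mem_Ioc] at ht
      exact h n n.lt_succ_self t ht.1 ht.2
    · rw [Nat.card_Ioc, batchEnd_succ, Nat.add_sub_cancel_left, nsmul_eq_mul]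

end BatchIndices

namespace RobustInstance

variable {d : ℕ} {k : EuclideanSpace ℝ (Fin d) → EuclideanSpace ℝ (Fin d) → ℝ}
  (I : RobustInstance d k) {σ a δ : ℝ} {T : ℕ} {sel : ℕ → Finset I.X → List I.X → I.X × I.X}
  {xs : I.X} {w : ℕ → ℝ}

lemma worst_le (g : I.X → ℝ) {x x' : I.X} (h : I.D x x' ≤ I.ξ) : I.worst g x ≤ g x' :=
  ciInf_le (f := fun y : {y : I.X // I.D x y ≤ I.ξ} => g y) (Set.finite_range _).bddBelow ⟨x', h⟩

lemma exists_eq_worst (g : I.X → ℝ) (x : I.X) : ∃ x', I.D x x' ≤ I.ξ ∧ g x' = I.worst g x := by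
  obtain ⟨x₀, h₀⟩ := I.exists_perturbation x
  have : Nonempty {y : I.X // I.D x y ≤ I.ξ} := ⟨⟨x₀, h₀⟩⟩
  obtain ⟨y, hy⟩ := exists_eq_ciInf_of_finite (f := fun y : {y : I.X // I.D x y ≤ I.ξ} => g y)
  exact ⟨y, y.2, hy⟩

lemma worst_le_worst_add {g h : I.X → ℝ} {x : I.X} {c : ℝ}
    (hgh : ∀ x', I.D x x' ≤ I.ξ → g x' ≤ h x' + c) : I.worst g x ≤ I.worst h x + c := by
  obtain ⟨x', hx', he⟩ := I.exists_eq_worst h x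
  rw [← he]
  exact (I.worst_le g hx').trans (hgh x' hx')

lemma worst_mono {g h : I.X → ℝ} (hgh : ∀ x, g x ≤ h x) (x : I.X) : I.worst g x ≤ I.worst h x := by
  simpa using I.worst_le_worst_add (g := g) (h := h) (x := x) (c := 0)
    (fun x' _ => by simpa using hgh x')

lemma sqrtBeta_nonneg (δ : ℝ) (B : ℕ) : 0 ≤ I.sqrtBeta δ B :=
  add_nonneg I.Ψ_pos.le (Real.sqrt_nonneg _)

lemma regret_le_two_mul (h1 : ∀ x, I.κ x x = 1) (x y : I.X) : I.regret x y ≤ 2 * I.Ψ := by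
  obtain ⟨H, _, _, φ, g, hφ, hg, hgΨ⟩ := I.exists_featureMap
  have hf : ∀ x, |I.f x| ≤ I.Ψ := by
    intro x
    have hn : ‖φ x‖ = 1 := by
      have := hφ x x
      rw [h1, real_inner_self_eq_norm_sq] at this
      nlinarith [norm_nonneg (φ x)]
    rw [hg]
    refine (abs_real_inner_le_norm _ _).trans ?_
    rwa [hn, mul_one]
  obtain ⟨x', _, hx⟩ := I.exists_eq_worst I.f x
  obtain ⟨y', _, hy⟩ := I.exists_eq_worst I.f y
  rw [regret, ← hx, ← hy]
  have := abs_le.1 (hf x')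
  have := abs_le.1 (hf y')
  linarith

/-- A robust optimal point is never eliminated while the confidence intervals hold. -/
lemma mem_active_of_confidenceHolds (hxs : I.IsRobustOptimal xs)
    (hc : I.ConfidenceHolds σ a T δ sel w) {i : ℕ} (hi : i ≤ numBatches a T) :
    xs ∈ I.active σ a T δ sel w i := by
  classical
  induction i with
  | zero => exact Finset.mem_univ _
  | succ i ih =>
    have hci := hc i hi
    rw [active, eliminate, Finset.mem_filter]
    refine ⟨ih (by omega), fun x' _ => ?_⟩
    refine ((I.worst_mono (fun y => ?_) x').trans (hxs x')).trans (I.worst_mono (fun y => ?_) xs)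
    · have := (abs_le.1 (hci y)).1
      rw [lcb]; linarith
    · have := (abs_le.1 (hci y)).2
      rw [ucb]; linarith

/-- A candidate that survives a batch has a regret of at most four confidence widths. -/
lemma regret_le_of_mem_active_succ (hσ : 0 < σ) (h1 : ∀ x, I.κ x x = 1)
    (hsel : I.IsMaxVarianceRule σ sel) (hxs : I.IsRobustOptimal xs)
    (hc : I.ConfidenceHolds σ a T δ sel w) {i : ℕ} (hi : i < numBatches a T)
    (hN : 0 < batchSize a T (i + 1)) {x : I.X} (hx : x ∈ I.active σ a T δ sel w (i + 1)) :
    I.regret xs x ≤ 4 * I.sqrtBeta δ (numBatches a T) *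
      √(varConst σ * I.gam σ (batchSize a T (i + 1)) / batchSize a T (i + 1)) := by
  classical
  obtain ⟨H, _, _, φ, g, hφ, -, -⟩ := I.exists_featureMap
  have hxs' := I.mem_active_of_confidenceHolds hxs hc hi.le
  have hci := hc i hi
  rw [active, eliminate, Finset.mem_filter] at hx
  obtain ⟨hxA, hx⟩ := hx
  set A := I.active σ a T δ sel w i
  set N := batchSize a T (i + 1)
  set L := I.queries sel (i + 1) A N
  set b := I.sqrtBeta δ (numBatches a T) with hb
  set v := √(varConst σ * I.gam σ N / N)
  have hb0 : 0 ≤ b := I.sqrtBeta_nonneg _ _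
  have hv : ∀ y ∈ A, ∀ y', I.D y y' ≤ I.ξ → b * postStd I.κ σ L y' ≤ b * v := by
    intro y hy y' hy'
    refine mul_le_mul_of_nonneg_left (Real.sqrt_le_sqrt ?_) hb0
    rw [le_div_iff₀ (by exact_mod_cast hN), mul_comm]
    exact I.mul_postVar_queries_le hφ hσ h1 hsel (i + 1) N hy hy'
  have e1 : I.worst (I.ucb σ b L (batchEnd a T i) w) x ≤ I.worst I.f x + 2 * (b * v) := by
    refine I.worst_le_worst_add fun y' hy' => ?_
    have := hv x hxA y' hy'
    have := (abs_le.1 (hci y')).1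
    rw [ucb]; linarith
  have e2 : I.worst I.f xs ≤ I.worst (I.lcb σ b L (batchEnd a T i) w) xs + 2 * (b * v) := by
    refine I.worst_le_worst_add fun y' hy' => ?_
    have := hv xs hxs' y' hy'
    have := (abs_le.1 (hci y')).2
    rw [lcb]; linarith
  have e3 := hx xs hxs'
  rw [regret]
  linarith

lemma chosen_mem_active (hsel : I.IsMaxVarianceRule σ sel) (hxs : I.IsRobustOptimal xs)
    (hc : I.ConfidenceHolds σ a T δ sel w) {i t : ℕ} (hi : i < numBatches a T)
    (h1 : batchEnd a T i < t) (h2 : t ≤ batchEnd a T (i + 1)) :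
    (I.chosen σ a T δ sel w t).1 ∈ I.active σ a T δ sel w i := by
  rw [chosen, batchIndex_eq h1 h2]
  exact (hsel _ _ _ ⟨xs, I.mem_active_of_confidenceHolds hxs hc hi.le⟩).1

lemma gam_mono (hσ : 0 < σ) : Monotone (I.gam σ) := by
  obtain ⟨H, _, _, φ, g, hφ, -, -⟩ := I.exists_featureMap
  have := I.nonempty_X
  exact monotone_maxInfoGain hφ hσ

lemma le_gam (hσ : 0 < σ) (h1 : ∀ x, I.κ x x = 1) {n : ℕ} (hn : 1 ≤ n) :
    1 / 2 * Real.log (1 + 1 / σ ^ 2) ≤ I.gam σ n := by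
  obtain ⟨H, _, _, φ, g, hφ, -, -⟩ := I.exists_featureMap
  have := I.nonempty_X
  exact le_maxInfoGain hφ hσ h1 hn

/-- The `ξ`-regret is at most `2 Ψ` in the first batch; in a later batch it is at most four
confidence widths of the batch before. -/
lemma cumRegret_le_sum_batches (hσ : 0 < σ) (h1 : ∀ x, I.κ x x = 1)
    (hsel : I.IsMaxVarianceRule σ sel) (hxs : I.IsRobustOptimal xs)
    (hc : I.ConfidenceHolds σ a T δ sel w) (hT : 1 ≤ T) {n : ℕ} (hn : numBatches a T = n + 1) :
    I.cumRegret σ a T δ sel xs w ≤ batchSize a T 1 * (2 * I.Ψ) +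
      ∑ i ∈ Finset.range n, batchSize a T (i + 2) * (4 * I.sqrtBeta δ (numBatches a T) *
        √(varConst σ * I.gam σ (batchSize a T (i + 1)) / batchSize a T (i + 1))) := by
  let ρ : ℕ → ℝ := fun i => match i with
    | 0 => 2 * I.Ψ
    | i + 1 => 4 * I.sqrtBeta δ (numBatches a T) *
        √(varConst σ * I.gam σ (batchSize a T (i + 1)) / batchSize a T (i + 1))
  have hsum := sum_Icc_batchEnd_le (a := a) (T := T)
    (F := I.regretAt σ a T δ sel xs w) (ρ := ρ) (numBatches a T) (by
      intro i hi t ht1 ht2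
      have hmem := I.chosen_mem_active hsel hxs hc hi ht1 ht2
      cases i with
      | zero => exact I.regret_le_two_mul h1 _ _
      | succ i =>
        refine I.regret_le_of_mem_active_succ hσ h1 hsel hxs hc (by omega) ?_ hmem
        rw [batchSize_eq_ceil hi]
        exact Nat.ceil_pos.2 (Real.rpow_pos_of_pos (by exact_mod_cast hT) _))
  rw [batchEnd_numBatches hT, hn, Finset.sum_range_succ'] at hsum
  rw [cumRegret]
  refine hsum.trans_eq ?_
  rw [add_comm, hn]
  simp only [ρ, zero_add, hn]

lemma regretAt_last_le (hσ : 0 < σ) (h1 : ∀ x, I.κ x x = 1)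
    (hsel : I.IsMaxVarianceRule σ sel) (hxs : I.IsRobustOptimal xs)
    (hc : I.ConfidenceHolds σ a T δ sel w) (hT : 1 ≤ T) {n : ℕ} (hn : numBatches a T = n + 2) :
    I.regretAt σ a T δ sel xs w T ≤ 4 * I.sqrtBeta δ (numBatches a T) *
      √(varConst σ * I.gam σ (batchSize a T (n + 1)) / batchSize a T (n + 1)) := by
  have hi : n + 1 < numBatches a T := by omega
  have hmem := I.chosen_mem_active hsel hxs hc hi (t := T) (batchEnd_lt hi)
    (by rw [show n + 1 + 1 = numBatches a T by omega, batchEnd_numBatches hT])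
  refine I.regret_le_of_mem_active_succ hσ h1 hsel hxs hc (by omega) ?_ hmem
  rw [batchSize_eq_ceil hi]
  exact Nat.ceil_pos.2 (Real.rpow_pos_of_pos (by exact_mod_cast hT) _)

end RobustInstance

/-! ### Growth of the batch sizes -/

section BatchGrowth

variable {a : ℝ} {T : ℕ}

lemma sum_inv_pow_le (ha0 : 0 < a) (ha1 : a < 1) (n : ℕ) :
    ∑ i ∈ Finset.range n, 1 / a ^ (i + 1) ≤ 1 / (a ^ n * (1 - a)) := by
  have h1a : 0 < 1 - a := by linarith
  induction n with
  | zero => simp [h1a.le]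
  | succ n ih =>
    rw [Finset.sum_range_succ]
    refine (add_le_add ih le_rfl).trans_eq ?_
    have := h1a.ne'
    field_simp
    ring

/-- The powers `T ^ (-s a ^ i)` grow doubly exponentially in `i`, so that their sum is comparable
to the last term. -/
lemma sum_rpow_neg_le (ha0 : 0 < a) (ha1 : a < 1) (hT : 2 ≤ T) {s : ℝ} (hs : 0 < s) (n : ℕ) :
    ∑ i ∈ Finset.range n, (T : ℝ) ^ (-(s * a ^ (i + 1))) ≤
      1 / (s * (a ^ n * Real.log T) * (1 - a)) := by
  have hT0 : (0 : ℝ) < T := by exact_mod_cast (by omega : 0 < T)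
  have hL : 0 < Real.log T := Real.log_pos (by exact_mod_cast (by omega : 1 < T))
  have hterm : ∀ i ∈ Finset.range n, (T : ℝ) ^ (-(s * a ^ (i + 1))) ≤
      1 / (s * Real.log T) * (1 / a ^ (i + 1)) := by
    intro i _
    have hx : 0 < Real.log T * (s * a ^ (i + 1)) := by positivity
    -- `exp (-x) ≤ 1 / x`
    rw [Real.rpow_def_of_pos hT0, mul_neg, Real.exp_neg, one_div_mul_one_div, ← one_div]
    refine one_div_le_one_div_of_le (by positivity) ?_
    have := Real.add_one_le_exp (Real.log T * (s * a ^ (i + 1)))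
    nlinarith
  refine (Finset.sum_le_sum hterm).trans ?_
  rw [← Finset.mul_sum]
  refine (mul_le_mul_of_nonneg_left (sum_inv_pow_le ha0 ha1 n) (by positivity)).trans_eq ?_
  rw [one_div_mul_one_div]
  congr 1
  ring

lemma batchEnd_eq_sum (n : ℕ) :
    batchEnd a T n = ∑ i ∈ Finset.range n, batchSize a T (i + 1) := by
  induction n with
  | zero => rfl
  | succ n ih => rw [Finset.sum_range_succ, ← ih, batchEnd_succ]

lemma batchSize_le_two_mul (ha0 : 0 < a) (ha1 : a < 1) (hT : 2 ≤ T) (i : ℕ) :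
    (batchSize a T (i + 1) : ℝ) ≤ 2 * (T : ℝ) ^ (1 - a ^ (i + 1)) := by
  have h1 : (1 : ℝ) ≤ (T : ℝ) ^ (1 - a ^ (i + 1)) :=
    Real.one_le_rpow (by exact_mod_cast (by omega : 1 ≤ T))
      (by have := pow_le_one₀ (n := i + 1) ha0.le ha1.le; linarith)
  have h2 := Nat.ceil_lt_add_one (zero_le_one.trans h1)
  have h3 : (batchSize a T (i + 1) : ℝ) ≤ (⌈(T : ℝ) ^ (1 - a ^ (i + 1))⌉₊ : ℝ) := by
    exact_mod_cast batchSize_le_ceil i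
  linarith

lemma le_batchSize {i : ℕ} (hi : i + 1 < numBatches a T) :
    (T : ℝ) ^ (1 - a ^ (i + 1)) ≤ batchSize a T (i + 1) := by
  rw [batchSize_eq_ceil hi]
  exact Nat.le_ceil _

/-- The batches suffice to exhaust the horizon, hence `T ^ (a ^ B)` is bounded. -/
lemma pow_numBatches_mul_log_le (ha0 : 0 < a) (ha1 : a < 1) (hT : 2 ≤ T) :
    a ^ numBatches a T * Real.log T ≤ 2 / (1 - a) := by
  have hT0 : (0 : ℝ) < T := by exact_mod_cast (by omega : 0 < T)
  have hL : 0 < Real.log T := Real.log_pos (by exact_mod_cast (by omega : 1 < T))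
  have h1a : 0 < 1 - a := by linarith
  set B := numBatches a T
  have hsum : (T : ℝ) = ∑ i ∈ Finset.range B, (batchSize a T (i + 1) : ℝ) := by
    have := batchEnd_numBatches (a := a) (T := T) (by omega)
    rw [batchEnd_eq_sum] at this
    exact_mod_cast this.symm
  have h1 : (T : ℝ) ≤ ∑ i ∈ Finset.range B, 2 * T * (T : ℝ) ^ (-(1 * a ^ (i + 1))) := by
    nth_rewrite 1 [hsum]
    refine Finset.sum_le_sum fun i _ => (batchSize_le_two_mul ha0 ha1 hT i).trans_eq ?_
    rw [sub_eq_add_neg, Real.rpow_add hT0, Real.rpow_one, one_mul, mul_assoc]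
  rw [← Finset.mul_sum] at h1
  have h2 := h1.trans (mul_le_mul_of_nonneg_left
    (sum_rpow_neg_le ha0 ha1 hT one_pos B) (by positivity : (0 : ℝ) ≤ 2 * T))
  have hx : 0 < a ^ B * Real.log T := by positivity
  rw [one_mul, mul_one_div, le_div_iff₀ (by positivity)] at h2
  rw [le_div_iff₀ h1a]
  have : (T : ℝ) * (a ^ B * Real.log T * (1 - a)) ≤ T * 2 := by linarith
  exact le_of_mul_le_mul_left this hT0

lemma three_le_numBatches (ha0 : 0 < a) (ha1 : a < 1) (hT : 2 ≤ T)
    (hL : 2 / (1 - a) < a ^ 2 * Real.log T) : 3 ≤ numBatches a T := by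
  by_contra! h
  have h1 := pow_numBatches_mul_log_le ha0 ha1 hT
  have h2 : a ^ 2 ≤ a ^ numBatches a T := pow_le_pow_of_le_one ha0.le ha1.le (by omega)
  have hlog : 0 ≤ Real.log T := Real.log_natCast_nonneg T
  have := mul_le_mul_of_nonneg_right h2 hlog
  linarith

/-- The full batches do not exhaust the horizon, hence `T ^ (a ^ (B - 2)) ≥ 2`. -/
lemma log_two_le (ha0 : 0 < a) (ha1 : a < 1) (hT : 2 ≤ T) {n : ℕ}
    (hn : numBatches a T = n + 3) : Real.log 2 ≤ a ^ (n + 1) * Real.log T := by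
  have hT1 : (1 : ℝ) ≤ T := by exact_mod_cast (by omega : 1 ≤ T)
  have hT0 : (0 : ℝ) < T := by linarith
  have h1 := le_batchSize (a := a) (T := T) (i := n) (by omega)
  have h2 := le_batchSize (a := a) (T := T) (i := n + 1) (by omega)
  have h3 : batchEnd a T (n + 1 + 1) < T := batchEnd_lt (by omega)
  have h4 : batchSize a T (n + 1) + batchSize a T (n + 1 + 1) ≤ T := by
    rw [batchEnd_succ, batchEnd_succ] at h3
    omega
  have h5 : (batchSize a T (n + 1) : ℝ) + batchSize a T (n + 1 + 1) ≤ T := by exact_mod_cast h4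
  have h6 : (T : ℝ) ^ (1 - a ^ (n + 1)) ≤ (T : ℝ) ^ (1 - a ^ (n + 1 + 1)) :=
    Real.rpow_le_rpow_of_exponent_le hT1 (by
      have : a ^ (n + 1 + 1) ≤ a ^ (n + 1) := pow_le_pow_of_le_one ha0.le ha1.le (by omega)
      linarith)
  have h7 : 2 * (T : ℝ) ^ (1 - a ^ (n + 1)) ≤ T := by linarith
  have h8 := Real.log_le_log (by positivity) h7
  rw [Real.log_mul two_ne_zero (by positivity), Real.log_rpow hT0] at h8
  linarith

/-- Each batch size is at most a power of the previous one, and the powers are such that the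
confidence widths of the previous batches add up to at most a constant times the last one. -/
lemma sum_batchSize_mul_le (ha0 : 0 < a) (ha1 : a < 1) (hT : 2 ≤ T) {η : ℝ} (hη : η < 1)
    (hs : 0 < a - (1 - η) / 2) {n : ℕ} (hn : numBatches a T = n + 3) :
    ∑ i ∈ Finset.range (n + 2), (batchSize a T (i + 2) : ℝ) *
        (batchSize a T (i + 1) : ℝ) ^ ((η - 1) / 2) ≤
      2 / ((a - (1 - η) / 2) * (a * Real.log 2) * (1 - a)) * (T : ℝ) ^ ((1 + η) / 2) := by
  have hT0 : (0 : ℝ) < T := by exact_mod_cast (by omega : 0 < T)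
  have h1a : 0 < 1 - a := by linarith
  set s := a - (1 - η) / 2 with hsdef
  have hterm : ∀ i ∈ Finset.range (n + 2), (batchSize a T (i + 2) : ℝ) *
        (batchSize a T (i + 1) : ℝ) ^ ((η - 1) / 2) ≤
      2 * (T : ℝ) ^ ((1 + η) / 2) * (T : ℝ) ^ (-(s * a ^ (i + 1))) := by
    intro i hi
    rw [Finset.mem_range] at hi
    have h1 := batchSize_le_two_mul (T := T) ha0 ha1 hT (i + 1)
    have h2 := le_batchSize (a := a) (T := T) (i := i) (by omega)
    have h3 : (batchSize a T (i + 1) : ℝ) ^ ((η - 1) / 2) ≤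
        ((T : ℝ) ^ (1 - a ^ (i + 1))) ^ ((η - 1) / 2) :=
      Real.rpow_le_rpow_of_nonpos (by positivity) h2 (by linarith)
    refine (mul_le_mul h1 h3 (by positivity) (by positivity)).trans_eq ?_
    rw [← Real.rpow_mul hT0.le, mul_assoc, mul_assoc, ← Real.rpow_add hT0, ← Real.rpow_add hT0]
    congr 2
    rw [hsdef]
    ring
  refine (Finset.sum_le_sum hterm).trans ?_
  rw [← Finset.mul_sum]
  have h4 := sum_rpow_neg_le ha0 ha1 hT hs (n + 2)
  have h5 : a * Real.log 2 ≤ a ^ (n + 2) * Real.log T := by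
    have := mul_le_mul_of_nonneg_left (log_two_le ha0 ha1 hT hn) ha0.le
    calc _ ≤ _ := this
      _ = _ := by ring
  have hl2 : 0 < Real.log 2 := Real.log_pos (by norm_num)
  have h6 : 1 / (s * (a ^ (n + 2) * Real.log T) * (1 - a)) ≤
      1 / (s * (a * Real.log 2) * (1 - a)) := by
    refine one_div_le_one_div_of_le (by positivity) ?_
    gcongr
  refine (mul_le_mul_of_nonneg_left (h4.trans h6) (by positivity)).trans_eq ?_
  ring

/-- The number of batches is of order `log log T`. -/
lemma log_numBatches_le (ha0 : 0 < a) (ha1 : a < 1) (hT : 2 ≤ T)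
    (hL : 2 / (1 - a) < a ^ 2 * Real.log T) (hLLL : 1 ≤ Real.log (Real.log (Real.log T))) :
    Real.log (numBatches a T) ≤
      (1 + Real.log (2 + 2 / Real.log (1 / a))) * Real.log (Real.log (Real.log T)) := by
  obtain ⟨n, hn⟩ := Nat.exists_eq_add_of_le' (three_le_numBatches ha0 ha1 hT hL)
  have hL0 : 0 < Real.log T := Real.log_pos (by exact_mod_cast (by omega : 1 < T))
  have hla : 0 < Real.log (1 / a) := Real.log_pos (by rw [lt_div_iff₀ ha0]; linarith)
  have hl2 : 0 < Real.log 2 := Real.log_pos (by norm_num)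
  set M := Real.log (Real.log T) with hM
  have hM1 : 1 ≤ M := by
    by_contra! h
    by_cases h0 : 0 ≤ M
    · have := Real.log_nonpos h0 h.le
      linarith
    · -- `log` of a negative number is the logarithm of its absolute value
      have hneg : Real.log T < 1 := by
        by_contra! h'
        exact h0 (Real.log_nonneg h')
      have h3 : 2 < Real.log T := by
        have h5 : 2 ≤ 2 / (1 - a) := by
          rw [le_div_iff₀ (by linarith)]; nlinarith
        have h6 : a ^ 2 * Real.log T ≤ 1 * Real.log T :=
          mul_le_mul_of_nonneg_right (by nlinarith) hL0.le
        linarith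
      linarith
  have h1 := Real.log_le_log hl2 (log_two_le ha0 ha1 hT hn)
  rw [Real.log_mul (by positivity) hL0.ne', Real.log_pow, ← hM] at h1
  have h2 : -1 ≤ Real.log (Real.log 2) := by
    have h3 : (1 / 2 : ℝ) ≤ Real.log 2 := by have := Real.log_two_gt_d9; linarith
    have h4 := Real.log_le_log (by norm_num) h3
    rw [one_div, Real.log_inv] at h4
    have := Real.log_two_lt_d9
    linarith
  have h3 : ((n : ℝ) + 1) * Real.log (1 / a) ≤ 2 * M := by
    rw [one_div, Real.log_inv]
    push_cast at h1
    linarith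
  have h4 : ((n : ℝ) + 1) ≤ 2 * M / Real.log (1 / a) := by rwa [le_div_iff₀ hla]
  have h5 : (numBatches a T : ℝ) ≤ (2 + 2 / Real.log (1 / a)) * M := by
    rw [hn]
    push_cast
    have : (2 + 2 / Real.log (1 / a)) * M = 2 * M + 2 * M / Real.log (1 / a) := by ring
    rw [this]
    linarith
  have hC : 1 ≤ 2 + 2 / Real.log (1 / a) := by
    have : 0 ≤ 2 / Real.log (1 / a) := by positivity
    linarith
  have hB0 : (0 : ℝ) < numBatches a T := by rw [hn]; positivity
  have h6 := Real.log_le_log hB0 h5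
  rw [Real.log_mul (by linarith) (by linarith)] at h6
  have := mul_le_mul_of_nonneg_left hLLL (Real.log_nonneg hC)
  linarith

end BatchGrowth

/-! ### Regret bounds in terms of the horizon -/

/-- Beyond a threshold the horizon is large enough for all estimates on the batches. -/
lemma exists_horizon (a : ℝ) (ha0 : 0 < a) : ∃ T₀ : ℕ, ∀ T ≥ T₀, 2 ≤ T ∧
    2 / (1 - a) < a ^ 2 * Real.log T ∧ 1 ≤ Real.log (Real.log (Real.log T)) ∧
    1 ≤ Real.log T := by
  have h0 : Filter.Tendsto (fun T : ℕ => Real.log (T : ℝ)) Filter.atTop Filter.atTop :=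
    Real.tendsto_log_atTop.comp tendsto_natCast_atTop_atTop
  have h1 := (h0.const_mul_atTop (by positivity : 0 < a ^ 2)).eventually_gt_atTop (2 / (1 - a))
  have h2 := (Real.tendsto_log_atTop.comp (Real.tendsto_log_atTop.comp h0)).eventually_ge_atTop 1
  have h3 := h0.eventually_ge_atTop 1
  obtain ⟨T₀, h⟩ := Filter.eventually_atTop.1
    ((Filter.eventually_ge_atTop 2).and (h1.and (h2.and h3)))
  exact ⟨T₀, h⟩

/-- No sign condition is needed, as `√` vanishes on negative numbers. -/
lemma sqrt_add_le_sqrt_add_sqrt (x y : ℝ) : √(x + y) ≤ √x + √y := by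
  have h : ∀ z : ℝ, z ≤ √z ^ 2 := fun z => by rw [Real.sq_sqrt']; exact le_max_left _ _
  refine Real.sqrt_le_iff.2 ⟨by positivity, ?_⟩
  have := h x
  have := h y
  have := mul_nonneg (Real.sqrt_nonneg x) (Real.sqrt_nonneg y)
  nlinarith

namespace RobustInstance

variable {d : ℕ} {k : EuclideanSpace ℝ (Fin d) → EuclideanSpace ℝ (Fin d) → ℝ}
  (I : RobustInstance d k)

lemma Lam_nonneg (δ : ℝ) : 0 ≤ I.Lam δ := add_nonneg I.Ψ_pos.le (Real.sqrt_nonneg _)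

/-- The union bound over the batches costs `√(log B)`, which is of order `√(log log log T)`. -/
lemma sqrtBeta_le {a : ℝ} (ha0 : 0 < a) (ha1 : a < 1) {T : ℕ} (hT : 2 ≤ T)
    (hL : 2 / (1 - a) < a ^ 2 * Real.log T) (hLLL : 1 ≤ Real.log (Real.log (Real.log T)))
    {δ : ℝ} (hδ : 0 < δ) :
    I.sqrtBeta δ (numBatches a T) ≤
      √2 * √(1 + Real.log (2 + 2 / Real.log (1 / a))) * (I.Lam δ + sqrtLogLogLog T) := by
  set c := 1 + Real.log (2 + 2 / Real.log (1 / a)) with hc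
  have hla : 0 < Real.log (1 / a) := Real.log_pos (by rw [lt_div_iff₀ ha0]; linarith)
  have hc1 : 1 ≤ c := by
    have : 0 ≤ 2 / Real.log (1 / a) := by positivity
    have := Real.log_nonneg (x := 2 + 2 / Real.log (1 / a)) (by linarith)
    linarith
  have hB : (0 : ℝ) < numBatches a T := by
    have := three_le_numBatches ha0 ha1 hT hL
    exact_mod_cast (by omega : 0 < numBatches a T)
  have hX : (0 : ℝ) < I.X.card := by exact_mod_cast I.nonempty.card_pos
  have h1 := log_numBatches_le ha0 ha1 hT hL hLLL
  have h2 : Real.log (I.X.card * numBatches a T / δ) =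
      Real.log (I.X.card / δ) + Real.log (numBatches a T) := by
    rw [← Real.log_mul (by positivity) hB.ne']
    congr 1
    ring
  have h3 : √(Real.log (I.X.card / δ) + Real.log (numBatches a T)) ≤
      √(Real.log (I.X.card / δ)) + √c * sqrtLogLogLog T := by
    refine (sqrt_add_le_sqrt_add_sqrt _ _).trans (add_le_add le_rfl ?_)
    rw [sqrtLogLogLog, ← Real.sqrt_mul (by linarith)]
    exact Real.sqrt_le_sqrt h1
  have h2c : 1 ≤ √c := Real.one_le_sqrt.2 hc1
  have h22 : 1 ≤ √2 := Real.one_le_sqrt.2 (by norm_num)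
  have h2c' : 1 ≤ √2 * √c := by nlinarith
  have hS := Real.sqrt_nonneg (Real.log (I.X.card / δ))
  rw [sqrtBeta, Lam, h2, Real.sqrt_mul two_pos.le]
  have h4 := mul_le_mul_of_nonneg_left h3 (Real.sqrt_nonneg 2)
  have h5 := mul_le_mul_of_nonneg_right h2c' I.Ψ_pos.le
  have h6 : √2 * √(Real.log (I.X.card / δ)) ≤ √2 * √c * √(Real.log (I.X.card / δ)) :=
    mul_le_mul_of_nonneg_right (by nlinarith) hS
  linarith

/-- The regret bounds on a noise path on which all confidence intervals hold. The bound on the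
cumulative regret is for information gains that are at most `G N ^ η` on the batch sizes `N`; the
reference level `Γ` (later `γ_T`, or a bound for it) has to dominate `G T ^ η` as well as the length
of the first batch. The bound on the regret at time `T` needs no such growth. -/
lemma exists_regret_bounds {σ a η K c : ℝ} (hσ : 0 < σ) (ha0 : 0 < a) (ha1 : a < 1) (hη : η < 1)
    (hs : 0 < a - (1 - η) / 2) (hK : 0 ≤ K) (hc : 0 ≤ c) :
    ∃ (C : ℝ) (T₀ : ℕ), 0 ≤ C ∧ ∀ T ≥ T₀, 1 ≤ numBatches a T ∧
      ∀ {d : ℕ} {k : EuclideanSpace ℝ (Fin d) → EuclideanSpace ℝ (Fin d) → ℝ}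
        (I : RobustInstance d k), (∀ x, I.κ x x = 1) → ∀ δ : ℝ, 0 < δ →
      ∀ sel, I.IsMaxVarianceRule σ sel → ∀ xs, I.IsRobustOptimal xs →
      ∀ w, I.ConfidenceHolds σ a T δ sel w →
        (∀ G Γ : ℝ, 0 ≤ G →
          (∀ i, 1 ≤ i → i < numBatches a T →
            I.gam σ (batchSize a T i) ≤ G * (batchSize a T i : ℝ) ^ η) →
          √(G * (T : ℝ) ^ (1 + η)) ≤ K * √(T * Γ) → (T : ℝ) ^ (1 - a) ≤ c * √(T * Γ) →
          I.cumRegret σ a T δ sel xs w ≤ C * (I.Lam δ + sqrtLogLogLog T) * √(T * Γ)) ∧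
        I.regretAt σ a T δ sel xs w T ≤
          C * (I.Lam δ + sqrtLogLogLog T) * √(I.gam σ T / T) := by
  obtain ⟨T₀, hT₀⟩ := exists_horizon a ha0
  have h1a : 0 < 1 - a := by linarith
  have hl2 : 0 < Real.log 2 := Real.log_pos (by norm_num)
  have hv := varConst_pos hσ
  set Cβ := √2 * √(1 + Real.log (2 + 2 / Real.log (1 / a))) with hCβ
  have hCβ0 : 0 ≤ Cβ := by positivity
  set D := 2 / ((a - (1 - η) / 2) * (a * Real.log 2) * (1 - a)) with hD
  have hD0 : 0 ≤ D := by positivity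
  set E := 2 / (a * (1 - a)) with hE
  set C₁ := 4 * c + 4 * Cβ * √(varConst σ) * D * K with hC₁
  set C₂ := 4 * Cβ * √(varConst σ * Real.exp E) with hC₂
  have hC₁0 : 0 ≤ C₁ := by positivity
  have hC₂0 : 0 ≤ C₂ := by positivity
  refine ⟨C₁ + C₂, T₀, by positivity, fun T hT => ?_⟩
  obtain ⟨hT2, hL, hLLL, -⟩ := hT₀ T hT
  obtain ⟨n, hn⟩ := Nat.exists_eq_add_of_le' (three_le_numBatches ha0 ha1 hT2 hL)
  refine ⟨by omega, fun {d k} I hk1 δ hδ sel hsel xs hxs w hconf => ?_⟩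
  have hT0 : (0 : ℝ) < T := by exact_mod_cast (by omega : 0 < T)
  have hβ := I.sqrtBeta_le ha0 ha1 hT2 hL hLLL hδ
  rw [← hCβ] at hβ
  have hΛ := I.Lam_nonneg δ
  have hll : 0 ≤ sqrtLogLogLog T := Real.sqrt_nonneg _
  have hΨ : I.Ψ ≤ I.Lam δ + sqrtLogLogLog T := by
    have := Real.sqrt_nonneg (Real.log (I.X.card / δ))
    rw [Lam]; linarith
  set Q := I.Lam δ + sqrtLogLogLog T with hQ
  have hQ0 : 0 ≤ Q := by positivity
  have hβ0 := I.sqrtBeta_nonneg δ (numBatches a T)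
  set b := I.sqrtBeta δ (numBatches a T) with hb
  constructor
  · intro G Γ hG hgam hGK hTc
    have hR0 := Real.sqrt_nonneg (T * Γ)
    refine (I.cumRegret_le_sum_batches hσ hk1 hsel hxs hconf (by omega)
      (n := n + 2) (by omega)).trans ?_
    have hfirst : (batchSize a T 1 : ℝ) * (2 * I.Ψ) ≤ 4 * c * Q * √(T * Γ) := by
      have h1 := batchSize_le_two_mul ha0 ha1 hT2 0
      rw [zero_add, pow_one] at h1
      have h2 : (batchSize a T 1 : ℝ) ≤ 2 * (c * √(T * Γ)) := h1.trans (by linarith)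
      refine (mul_le_mul h2 (by linarith : 2 * I.Ψ ≤ 2 * Q) (by linarith [I.Ψ_pos])
        (by positivity)).trans_eq (by ring)
    have hterm : ∀ i ∈ Finset.range (n + 2), (batchSize a T (i + 2) : ℝ) * (4 * b *
        √(varConst σ * I.gam σ (batchSize a T (i + 1)) / batchSize a T (i + 1))) ≤
        4 * b * √(varConst σ) * √G * ((batchSize a T (i + 2) : ℝ) *
          (batchSize a T (i + 1) : ℝ) ^ ((η - 1) / 2)) := by
      intro i hi
      rw [Finset.mem_range] at hi
      set N := batchSize a T (i + 1)
      have hN : (0 : ℝ) < N :=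
        (Real.rpow_pos_of_pos hT0 _).trans_le (le_batchSize (i := i) (by omega))
      have h1 : √(varConst σ * I.gam σ N / N) ≤ √(varConst σ) * √G * (N : ℝ) ^ ((η - 1) / 2) := by
        have h2 : varConst σ * I.gam σ N / N ≤ varConst σ * G * (N : ℝ) ^ (η - 1) := by
          rw [Real.rpow_sub_one hN.ne', ← mul_div_assoc]
          refine div_le_div_of_nonneg_right ?_ hN.le
          rw [mul_assoc]
          exact mul_le_mul_of_nonneg_left (hgam (i + 1) (by omega) (by omega)) hv.le
        refine (Real.sqrt_le_sqrt h2).trans_eq ?_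
        rw [Real.sqrt_mul (by positivity), Real.sqrt_mul hv.le, Real.sqrt_eq_rpow ((N : ℝ) ^ _),
          ← Real.rpow_mul hN.le, mul_one_div]
      calc _ ≤ (batchSize a T (i + 2) : ℝ) * (4 * b *
            (√(varConst σ) * √G * (N : ℝ) ^ ((η - 1) / 2))) := by gcongr
        _ = _ := by ring
    have hsum := Finset.sum_le_sum hterm
    rw [← Finset.mul_sum] at hsum
    have hpow : √G * (T : ℝ) ^ ((1 + η) / 2) ≤ K * √(T * Γ) := by
      refine le_trans (le_of_eq ?_) hGK
      rw [Real.sqrt_mul hG, Real.sqrt_eq_rpow ((T : ℝ) ^ _), ← Real.rpow_mul hT0.le, mul_one_div]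
    have hmain : ∑ i ∈ Finset.range (n + 2), (batchSize a T (i + 2) : ℝ) * (4 * b *
        √(varConst σ * I.gam σ (batchSize a T (i + 1)) / batchSize a T (i + 1))) ≤
        4 * Cβ * √(varConst σ) * D * K * Q * √(T * Γ) := by
      refine hsum.trans ?_
      have hsb := sum_batchSize_mul_le ha0 ha1 hT2 hη hs hn
      rw [← hD] at hsb
      calc _ ≤ 4 * b * √(varConst σ) * √G * (D * (T : ℝ) ^ ((1 + η) / 2)) := by gcongr
        _ = 4 * b * √(varConst σ) * D * (√G * (T : ℝ) ^ ((1 + η) / 2)) := by ring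
        _ ≤ 4 * (Cβ * Q) * √(varConst σ) * D * (K * √(T * Γ)) := by gcongr
        _ = _ := by ring
    have hC₂' : 0 ≤ C₂ * Q * √(T * Γ) := by positivity
    calc _ ≤ 4 * c * Q * √(T * Γ) + 4 * Cβ * √(varConst σ) * D * K * Q * √(T * Γ) :=
          add_le_add hfirst hmain
      _ ≤ _ := by rw [hC₁]; linarith
  · -- the batch before the last one has at least `T / exp E` queries
    refine (I.regretAt_last_le hσ hk1 hsel hxs hconf (by omega) (n := n + 1) hn).trans ?_
    set N := batchSize a T (n + 1 + 1) with hNdef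
    have hNge : (T : ℝ) ^ (1 - a ^ (n + 1 + 1)) ≤ N := le_batchSize (by omega)
    have hN : (T : ℝ) * Real.exp (-E) ≤ N := by
      refine le_trans ?_ hNge
      rw [sub_eq_add_neg, Real.rpow_add hT0, Real.rpow_one, Real.rpow_def_of_pos hT0]
      refine mul_le_mul_of_nonneg_left (Real.exp_le_exp.2 ?_) hT0.le
      have h1 := pow_numBatches_mul_log_le ha0 ha1 hT2
      rw [hn] at h1
      have h2 : a * (a ^ (n + 1 + 1) * Real.log T) ≤ a * E := by
        have : a * E = 2 / (1 - a) := by rw [hE]; field_simp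
        rw [this]
        calc _ = a ^ (n + 3) * Real.log T := by ring
          _ ≤ _ := h1
      have := le_of_mul_le_mul_left h2 ha0
      linarith
    have hN0 : (0 : ℝ) < N := lt_of_lt_of_le (by positivity) hN
    have hgT : I.gam σ N ≤ I.gam σ T := I.gam_mono hσ (by
      have := batchEnd_le a T (n + 1 + 1)
      rw [batchEnd_succ] at this
      omega)
    have hg0 : 0 ≤ I.gam σ N := by
      have := I.le_gam hσ hk1 (n := N) (by exact_mod_cast hN0)
      have := log_one_add_inv_sq_pos hσ
      linarith
    have hgT0 : 0 ≤ varConst σ * I.gam σ T := mul_nonneg hv.le (hg0.trans hgT)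
    have hsq : √(varConst σ * I.gam σ N / N) ≤
        √(varConst σ * Real.exp E) * √(I.gam σ T / T) := by
      rw [← Real.sqrt_mul (by positivity)]
      refine Real.sqrt_le_sqrt ?_
      calc varConst σ * I.gam σ N / N ≤ varConst σ * I.gam σ T / (T * Real.exp (-E)) := by gcongr
        _ = _ := by rw [Real.exp_neg]; field_simp
    have hR0 := Real.sqrt_nonneg (I.gam σ T / T)
    have hC₁' : 0 ≤ C₁ * Q * √(I.gam σ T / T) := by positivity
    calc _ ≤ 4 * (Cβ * Q) * (√(varConst σ * Real.exp E) * √(I.gam σ T / T)) := by gcongr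
      _ = C₂ * Q * √(I.gam σ T / T) := by rw [hC₂]; ring
      _ ≤ _ := by linarith

end RobustInstance

/-! ### Well-behaved growth bounds -/

section WellBehaved

variable {a : ℝ} {α : ℕ → ℝ}

lemma rpow_le_batchSize (ha0 : 0 < a) (ha1 : a < 1) {T : ℕ} (hT : 1 ≤ T) {i : ℕ} (hi1 : 1 ≤ i)
    (hi : i < numBatches a T) : (T : ℝ) ^ (1 - a) ≤ batchSize a T i := by
  obtain ⟨j, rfl⟩ := Nat.exists_eq_add_of_le' hi1
  refine le_trans (Real.rpow_le_rpow_of_exponent_le (by exact_mod_cast hT) ?_) (le_batchSize hi)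
  have : a ^ (j + 1) ≤ a := pow_le_of_le_one ha0.le ha1.le j.succ_ne_zero
  linarith

lemma exists_le_batchSize (ha0 : 0 < a) (ha1 : a < 1) (m : ℕ) :
    ∃ T₀ : ℕ, ∀ T ≥ T₀, ∀ i, 1 ≤ i → i < numBatches a T → m ≤ batchSize a T i := by
  have h : Filter.Tendsto (fun T : ℕ => (T : ℝ) ^ (1 - a)) Filter.atTop Filter.atTop :=
    (tendsto_rpow_atTop (by linarith)).comp tendsto_natCast_atTop_atTop
  obtain ⟨T₀, hT₀⟩ := Filter.eventually_atTop.1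
    ((Filter.eventually_ge_atTop 1).and (h.eventually_ge_atTop (m : ℝ)))
  refine ⟨T₀, fun T hT i hi1 hi => ?_⟩
  have := (hT₀ T hT).2.trans (rpow_le_batchSize ha0 ha1 (hT₀ T hT).1 hi1 hi)
  exact_mod_cast this

/-- A well-behaved sequence that is bounded below by some power of `t` is bounded below by
arbitrarily small negative powers: `α_{N_1} ≤ K α_T`, where `N_1` is of order `T ^ (1 - a)`, turns
the exponent `-η` into `-η (1 - a)`, and this can be iterated. -/
lemma WellBehaved.exists_rpow_le (hα : WellBehaved a α) (ha0 : 0 < a) (ha1 : a < 1) {η c₀ : ℝ}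
    (hη : 0 ≤ η) (hc₀ : 0 < c₀) {t₀ : ℕ} (h0 : ∀ t ≥ t₀, c₀ * (t : ℝ) ^ (-η) ≤ α t) (m : ℕ) :
    ∃ c > 0, ∃ T₀ : ℕ, ∀ T ≥ T₀, c * (T : ℝ) ^ (-(η * (1 - a) ^ m)) ≤ α T := by
  have h1a : 0 < 1 - a := by linarith
  induction m with
  | zero => exact ⟨c₀, hc₀, t₀, by simpa using h0⟩
  | succ m ih =>
    obtain ⟨c, hc, T₁, hT₁⟩ := ih
    obtain ⟨K, T₂, hK⟩ := hα
    obtain ⟨T₃, hT₃⟩ := exists_le_batchSize ha0 ha1 T₁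
    obtain ⟨T₄, hT₄⟩ := exists_horizon a ha0
    set x := η * (1 - a) ^ m with hx
    have hx0 : 0 ≤ x := by positivity
    refine ⟨c * 2 ^ (-x) / (|K| + 1), by positivity, T₁ + T₂ + T₃ + T₄ + t₀, fun T hT => ?_⟩
    obtain ⟨hT2, hL, -, -⟩ := hT₄ T (by omega)
    have hB := three_le_numBatches ha0 ha1 hT2 hL
    have hT0 : (0 : ℝ) < T := by exact_mod_cast (by omega : 0 < T)
    have hN := hT₁ _ (hT₃ T (by omega) 1 le_rfl (by omega))
    have hKN := hK T (by omega) 1 le_rfl (by omega)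
    have hN2 := batchSize_le_two_mul ha0 ha1 hT2 0
    have hN0 : (0 : ℝ) < batchSize a T 1 :=
      (Real.rpow_pos_of_pos hT0 _).trans_le
        (rpow_le_batchSize ha0 ha1 (by omega) le_rfl (by omega))
    rw [zero_add, pow_one] at hN2
    have hpos : 0 ≤ α T := le_trans (by positivity) (h0 T (by omega))
    have h1 : c * (2 * (T : ℝ) ^ (1 - a)) ^ (-x) ≤ c * (batchSize a T 1 : ℝ) ^ (-x) :=
      mul_le_mul_of_nonneg_left (Real.rpow_le_rpow_of_nonpos hN0 hN2 (by linarith)) hc.le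
    rw [Real.mul_rpow two_pos.le (by positivity), ← Real.rpow_mul hT0.le] at h1
    have h2 : K * α T ≤ (|K| + 1) * α T :=
      mul_le_mul_of_nonneg_right (by linarith [le_abs_self K]) hpos
    rw [div_mul_eq_mul_div, div_le_iff₀ (by positivity)]
    have h3 : -(η * (1 - a) ^ (m + 1)) = (1 - a) * -x := by rw [hx]; ring
    rw [h3]
    linarith

end WellBehaved

lemma seKernel_self {d : ℕ} (l : ℝ) (x : EuclideanSpace ℝ (Fin d)) : seKernel l x x = 1 := by
  simp [seKernel]

lemma maternKernel_self {d : ℕ} (ν l : ℝ) (x : EuclideanSpace ℝ (Fin d)) :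
    maternKernel ν l x x = 1 := if_pos rfl

end RobustBPE

end
open RobustBPE in
theorem theorem3 (d : ℕ) (σ : ℝ) (hσ : 0 < σ) :
    (∀ k : EuclideanSpace ℝ (Fin d) → EuclideanSpace ℝ (Fin d) → ℝ,
      ((∃ l > 0, k = seKernel l) ∨ (∃ ν > 0, ∃ l > 0, k = maternKernel ν l)) →
      ∀ a : ℝ, 1 / 2 < a → a < 1 →
      ∃ (C : ℝ) (T₀ : ℕ), ∀ T ≥ T₀, ∀ (I : RobustInstance d k) (δ : ℝ), 0 < δ → δ < 1 →
      ∀ sel, I.IsMaxVarianceRule σ sel → ∀ xs, I.IsRobustOptimal xs →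
      ∀ {Ω : Type*} [MeasurableSpace Ω] (μ : Measure Ω) [IsProbabilityMeasure μ]
        (z : ℕ → Ω → ℝ), IsGaussianNoise σ T μ z →
        ENNReal.ofReal (1 - δ) ≤ μ {ω |
          I.cumRegret σ a T δ sel xs (fun t => z t ω)
              ≤ C * (I.Lam δ + sqrtLogLogLog T) * √(T * I.gam σ T) ∧
          I.regretAt σ a T δ sel xs (fun t => z t ω) T
              ≤ C * (I.Lam δ + sqrtLogLogLog T) * √(I.gam σ T / T)}) ∧
    (∀ ν > 0, ∀ l > 0, ∀ a : ℝ, ν / (2 * ν + d) < a → a ≤ 1 / 2 →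
      ∀ (c : ℝ) (α : ℕ → ℝ) (t₀ : ℕ), 0 < c → WellBehaved a α →
      ∃ (C : ℝ) (T₀ : ℕ), ∀ T ≥ T₀,
      ∀ (I : RobustInstance d (maternKernel ν l)), (∀ t ≥ t₀, I.gam σ t ≤ gammaBar d ν c α t) →
      ∀ δ : ℝ, 0 < δ → δ < 1 →
      ∀ sel, I.IsMaxVarianceRule σ sel → ∀ xs, I.IsRobustOptimal xs →
      ∀ {Ω : Type*} [MeasurableSpace Ω] (μ : Measure Ω) [IsProbabilityMeasure μ]
        (z : ℕ → Ω → ℝ), IsGaussianNoise σ T μ z →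
        ENNReal.ofReal (1 - δ) ≤ μ {ω |
          I.cumRegret σ a T δ sel xs (fun t => z t ω)
              ≤ C * (I.Lam δ + sqrtLogLogLog T) * √(T * gammaBar d ν c α T) ∧
          I.regretAt σ a T δ sel xs (fun t => z t ω) T
              ≤ C * (I.Lam δ + sqrtLogLogLog T) * √(gammaBar d ν c α T / T) ∧
          I.regretAt σ a T δ sel xs (fun t => z t ω) T
              ≤ C * (I.Lam δ + sqrtLogLogLog T) * Real.log T * √(I.gam σ T / T)}) := by
  set g₀ := 1 / 2 * Real.log (1 + 1 / σ ^ 2) with hg₀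
  have hg₀0 : 0 < g₀ := by
    have := log_one_add_inv_sq_pos hσ
    positivity
  refine ⟨fun k hk a ha ha1 => ?_, fun ν hν l hl a ha ha2 c α t₀ hc hα => ?_⟩
  · have hk1 : ∀ x, k x x = 1 := by
      rcases hk with ⟨l, -, rfl⟩ | ⟨ν, -, l, -, rfl⟩
      · exact seKernel_self l
      · exact maternKernel_self ν l
    have ha0 : 0 < a := by linarith
    obtain ⟨C, T₀, -, hC⟩ := RobustInstance.exists_regret_bounds (η := 0) (K := 1) (c := 1 / √g₀)
      hσ ha0 ha1 zero_lt_one (by linarith) zero_le_one (by positivity)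
    refine ⟨C, T₀ + 1, fun T hT I δ hδ hδ1 sel hsel xs hxs Ω _ μ _ z hz => ?_⟩
    obtain ⟨hB, hreg⟩ := hC T (by omega)
    refine I.le_measure_confidenceHolds (sel := sel) hσ hz a hB hδ hδ1 fun ω hω => ?_
    obtain ⟨hcum, hlast⟩ := hreg I (fun x => hk1 x) δ hδ sel hsel xs hxs _ hω
    have hT1 : (1 : ℝ) ≤ T := by exact_mod_cast (by omega : 1 ≤ T)
    have hgT : g₀ ≤ I.gam σ T := I.le_gam hσ (fun x => hk1 x) (by omega)
    refine ⟨hcum (I.gam σ T) (I.gam σ T) (hg₀0.le.trans hgT) (fun i _ _ => ?_) ?_ ?_, hlast⟩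
    · rw [Real.rpow_zero, mul_one]
      exact I.gam_mono hσ ((min_le_right _ _).trans (Nat.sub_le _ _))
    · rw [add_zero, Real.rpow_one, one_mul, mul_comm]
    · have h1 : (T : ℝ) ^ (1 - a) ≤ √T := by
        rw [Real.sqrt_eq_rpow]
        exact Real.rpow_le_rpow_of_exponent_le hT1 (by linarith)
      have h2 : √T * √g₀ ≤ √(T * I.gam σ T) := by
        rw [← Real.sqrt_mul (by linarith)]
        exact Real.sqrt_le_sqrt (mul_le_mul_of_nonneg_left hgT (by linarith))
      rw [one_div_mul_eq_div, le_div_iff₀ (Real.sqrt_pos.2 hg₀0)]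
      exact (mul_le_mul_of_nonneg_right h1 (Real.sqrt_nonneg _)).trans h2
  · have hk1 : ∀ x : EuclideanSpace ℝ (Fin d), maternKernel ν l x x = 1 := maternKernel_self ν l
    -- without an instance that satisfies the bound on the information gain nothing is claimed;
    -- with one, the bound forces `α` to be positive
    by_cases hex : ∃ I : RobustInstance d (maternKernel ν l),
        ∀ t ≥ t₀, I.gam σ t ≤ gammaBar d ν c α t
    swap
    · exact ⟨0, 0, fun T _ I hI => absurd ⟨I, hI⟩ hex⟩
    obtain ⟨I₀, hI₀⟩ := hex
    set η : ℝ := (d : ℝ) / (2 * ν + d) with hη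
    have hden : 0 < 2 * ν + d := by positivity
    have hη0 : 0 ≤ η := by positivity
    have hη1 : η < 1 := by rw [hη, div_lt_one hden]; linarith
    have hη2 : (1 - η) / 2 = ν / (2 * ν + d) := by rw [hη]; field_simp; ring
    have ha0 : 0 < a := lt_trans (by positivity) ha
    have ha1 : a < 1 := by linarith
    have hs : 0 < a - (1 - η) / 2 := by rw [hη2]; linarith
    have hlow : ∀ t ≥ t₀ + 1, g₀ / c * (t : ℝ) ^ (-η) ≤ α t := by
      intro t ht
      have ht0 : (0 : ℝ) < t := by exact_mod_cast (by omega : 0 < t)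
      have h1 := (I₀.le_gam hσ (fun x => hk1 x) (n := t) (by omega)).trans
        (hI₀ t (by omega))
      rw [gammaBar, ← hg₀, ← hη] at h1
      rw [Real.rpow_neg ht0.le, div_mul_eq_mul_div, div_le_iff₀ hc, ← div_eq_mul_inv,
        div_le_iff₀ (by positivity)]
      linarith
    -- a lower bound on `α` by a power with exponent above `-2 s` makes the first batch negligible
    obtain ⟨m, hm⟩ := exists_pow_lt_of_lt_one (x := 2 * (a - (1 - η) / 2)) (y := 1 - a)
      (by linarith) (by linarith)
    obtain ⟨c₁, hc₁, T₁, hT₁⟩ := hα.exists_rpow_le ha0 ha1 hη0 (div_pos hg₀0 hc) hlow m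
    obtain ⟨K, T₂, hK⟩ := hα
    obtain ⟨T₃, hT₃⟩ := exists_le_batchSize ha0 ha1 t₀
    obtain ⟨T₄, hT₄⟩ := exists_horizon a ha0
    obtain ⟨C, T₅, hC0, hC⟩ := RobustInstance.exists_regret_bounds (η := η) (K := √|K|)
      (c := 1 / √(c * c₁)) hσ ha0 ha1 hη1 hs (Real.sqrt_nonneg _) (by positivity)
    refine ⟨C, T₁ + T₂ + T₃ + T₄ + T₅ + t₀ + 1,
      fun T hT I hI δ hδ hδ1 sel hsel xs hxs Ω _ μ _ z hz => ?_⟩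
    obtain ⟨hB, hreg⟩ := hC T (by omega)
    obtain ⟨hT2, -, -, hlogT⟩ := hT₄ T (by omega)
    refine I.le_measure_confidenceHolds (sel := sel) hσ hz a hB hδ hδ1 fun ω hω => ?_
    obtain ⟨hcum, hlast⟩ := hreg I (fun x => hk1 x) δ hδ sel hsel xs hxs _ hω
    have hT1 : (1 : ℝ) ≤ T := by exact_mod_cast (by omega : 1 ≤ T)
    have hT0 : (0 : ℝ) < T := by linarith
    have hαT : 0 ≤ α T := le_trans (by positivity) (hT₁ T (by omega))
    have hQ : 0 ≤ C * (I.Lam δ + sqrtLogLogLog T) :=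
      mul_nonneg hC0 (add_nonneg (I.Lam_nonneg δ) (Real.sqrt_nonneg _))
    have hTg : (T : ℝ) * gammaBar d ν c α T = c * α T * (T : ℝ) ^ (1 + η) := by
      rw [gammaBar, ← hη, Real.rpow_add hT0, Real.rpow_one]
      ring
    refine ⟨hcum (c * |K| * α T) _ (by positivity) (fun i hi1 hi => ?_) ?_ ?_, ?_, ?_⟩
    · refine (hI _ (hT₃ T (by omega) i hi1 hi)).trans ?_
      have h1 : α (batchSize a T i) ≤ |K| * α T := (hK T (by omega) i hi1 hi).trans
        (mul_le_mul_of_nonneg_right (le_abs_self K) hαT)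
      rw [gammaBar, ← hη]
      calc _ ≤ c * (batchSize a T i : ℝ) ^ η * (|K| * α T) := by gcongr
        _ = _ := by ring
    · rw [← Real.sqrt_mul (abs_nonneg K), hTg]
      refine le_of_eq ?_
      congr 1
      ring
    · have h1 : c * c₁ * (T : ℝ) ^ (2 * (1 - a)) ≤ T * gammaBar d ν c α T := by
        rw [hTg]
        have h2 : (T : ℝ) ^ (2 * (1 - a)) ≤
            (T : ℝ) ^ (-(η * (1 - a) ^ m)) * (T : ℝ) ^ (1 + η) := by
          rw [← Real.rpow_add hT0]
          refine Real.rpow_le_rpow_of_exponent_le hT1 ?_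
          have h3 : η * (1 - a) ^ m ≤ 1 * (1 - a) ^ m :=
            mul_le_mul_of_nonneg_right hη1.le (pow_nonneg (by linarith) _)
          linarith
        calc c * c₁ * (T : ℝ) ^ (2 * (1 - a)) ≤
              c * c₁ * ((T : ℝ) ^ (-(η * (1 - a) ^ m)) * (T : ℝ) ^ (1 + η)) := by gcongr
          _ = c * (c₁ * (T : ℝ) ^ (-(η * (1 - a) ^ m))) * (T : ℝ) ^ (1 + η) := by ring
          _ ≤ _ := by gcongr; exact hT₁ T (by omega)
      have h2 := Real.sqrt_le_sqrt h1
      rw [Real.sqrt_mul (by positivity), Real.sqrt_eq_rpow ((T : ℝ) ^ _),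
        ← Real.rpow_mul hT0.le, show 2 * (1 - a) * (1 / 2) = 1 - a by ring] at h2
      rw [one_div_mul_eq_div, le_div_iff₀ (Real.sqrt_pos.2 (by positivity)), mul_comm]
      exact h2
    · refine hlast.trans (mul_le_mul_of_nonneg_left (Real.sqrt_le_sqrt ?_) hQ)
      exact div_le_div_of_nonneg_right (hI T (by omega)) hT0.le
    · refine hlast.trans (mul_le_mul_of_nonneg_right ?_ (Real.sqrt_nonneg _))
      exact le_mul_of_one_le_right hQ hlogT
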